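/- Let $\mathbb T$ be the unit circle with normalized Lebesgue measure, let $H^2\subset L^2(\mathbb T)$ be the Hardy space (functions whose negative Fourier coefficients vanish), $H_0^2=zH^2$, and write $\overline{N}=\{\overline h: h\in N\}$ for $N\subseteq L^2(\mathbb T)$. A function is inner if it belongs to $H^2$ and is unimodular a.e. on $\mathbb T$. For an inner function $\theta$ put $K_\theta=H^2\ominus\theta H^2$, let $P_\theta$ be the orthogonal projection of $L^2(\mathbb T)$ onto $K_\theta$, let $K_\theta^\perp=L^2(\mathbb T)\ominus K_\theta$, and define $U_\theta h=(I-P_\theta)(zh)$ for $h\in K_\theta^\perp$. A closed subspace $M\subseteq K_\theta^\perp$ is nearly $U_\theta$-invariant if $U_\theta(M\cap U_\theta^*K_\theta^\perp)\subseteq M$. **Theorem.** Let $\theta$ be inner with $\theta(0)=0$, and let $M$ be a nearly $U_\theta$-invariant subspace of $K_\theta^\perp$ with $\{0\}\ne M\neq K_\theta^\perp$, of the form $M=M_-\oplus M_+$ where $M_-$ is a closed subspace of $\overline{H_0^2}$ and $M_+$ is a closed subspace of $\theta H^2$. Then $M$ is of one of the following ten forms (all sums are orthogonal): $$\theta H^2,\quad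 \gamma\theta H^2,\quad \overline{H_0^2},\quad g\,\overline{K_\alpha},\quad \overline{H_0^2}\oplus\gamma\theta H^2,\quad g\,\overline{K_\alpha}\oplus\gamma\theta H^2,\quad g\,\overline{K_\alpha}\oplus\theta H^2,$$ $$\overline{\eta H^2},\quad \overline{\eta H^2}\oplus\theta H^2,\quad \overline{\eta H^2}\oplus\gamma\theta H^2.$$ Here $\gamma$ is a nonconstant inner function; $\alpha$ is an inner function; $\eta$ is an inner function with a simple zero at the origin, that is, $\eta=z\eta_1$ with $\eta_1$ inner and $\eta_1(0)\ne0$; and, in the forms in which $g$ occurs, $g$ is the unit vector in $M\ominus(M\cap\{\bar z\}^\perp)$ for which $\langle g,\bar z\rangle$ is real, with the sign chosen so that $\langle g,\bar z\rangle>0$; moreover $g\in\overline{H_0^2}$, and $g\overline{h}\in L^2(\mathbb T)$ for every $h\in K_\alpha$. -/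

import Mathlib

open MeasureTheory AddCircle

noncomputable section

namespace DualShift

/-- `L²(𝕋)`, the circle being `ℝ/ℤ` (a point `t` stands for `exp (2πit)`) with normalized Lebesgue
measure. The function `z ^ n` is `fourier n`, whose class is `fourierLp 2 n`. -/
abbrev L2 : Type := Lp ℂ 2 (haarAddCircle (T := (1 : ℝ)))

theorem fourierCoeff_add (f g : L2) (n : ℤ) :
    fourierCoeff (⇑(f + g)) n = fourierCoeff f n + fourierCoeff g n := by
  simp only [← fourierBasis_repr, map_add]
  rfl

theorem fourierCoeff_smul (c : ℂ) (f : L2) (n : ℤ) :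
    fourierCoeff (⇑(c • f)) n = c * fourierCoeff f n := by
  simp only [← fourierBasis_repr, map_smul]
  rfl

theorem fourierCoeff_zero (n : ℤ) : fourierCoeff (⇑(0 : L2)) n = 0 := by
  simp only [← fourierBasis_repr, map_zero]
  rfl

/-- The functions in `L²(𝕋)` whose Fourier coefficients of index `< k` vanish. -/
def hardyFrom (k : ℤ) : Submodule ℂ L2 where
  carrier := {f | ∀ n : ℤ, n < k → fourierCoeff f n = 0}
  add_mem' {f g} hf hg n hn := by rw [fourierCoeff_add, hf n hn, hg n hn, add_zero]
  zero_mem' n _ := fourierCoeff_zero n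
  smul_mem' c f hf n hn := by rw [fourierCoeff_smul, hf n hn, mul_zero]

/-- The Hardy space `H²`. -/
def H2 : Submodule ℂ L2 := hardyFrom 0

/-- `H₀² = zH²`, the functions of the Hardy space with mean zero. -/
def H2zero : Submodule ℂ L2 := hardyFrom 1

/-- Inner functions, given by their boundary values: functions in `H²` that are unimodular
almost everywhere on the circle. -/
def IsInner (θ : L2) : Prop := θ ∈ H2 ∧ ∀ᵐ t ∂haarAddCircle, ‖θ t‖ = 1

/-- Inner functions that are not (almost everywhere) constant. -/
def IsNonconstInner (θ : L2) : Prop :=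
  IsInner θ ∧ ¬ ∃ c : ℂ, ∀ᵐ t ∂haarAddCircle, θ t = c

/-- The space `φN` of those `f ∈ L²(𝕋)` that are of the form `φh`, `h ∈ N`. -/
def mulSpace (φ : L2) (N : Submodule ℂ L2) : Submodule ℂ L2 where
  carrier := {f | ∃ h ∈ N, ∀ᵐ t ∂haarAddCircle, f t = φ t * h t}
  add_mem' := by
    rintro f f' ⟨h, hh, e⟩ ⟨h', hh', e'⟩
    refine ⟨h + h', N.add_mem hh hh', ?_⟩
    filter_upwards [e, e', Lp.coeFn_add f f', Lp.coeFn_add h h'] with t a b c d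
    rw [c, d, Pi.add_apply, Pi.add_apply, a, b, mul_add]
  zero_mem' := by
    refine ⟨0, N.zero_mem, ?_⟩
    filter_upwards [Lp.coeFn_zero ℂ 2 (haarAddCircle (T := (1 : ℝ)))] with t a
    rw [a, Pi.zero_apply, mul_zero]
  smul_mem' := by
    rintro c f ⟨h, hh, e⟩
    refine ⟨c • h, N.smul_mem c hh, ?_⟩
    filter_upwards [e, Lp.coeFn_smul c f, Lp.coeFn_smul c h] with t a b d
    rw [b, d, Pi.smul_apply, Pi.smul_apply, a, smul_eq_mul, smul_eq_mul, mul_left_comm]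

/-- The space of complex conjugates of the functions in `N`. -/
def conjSpace (N : Submodule ℂ L2) : Submodule ℂ L2 where
  carrier := {f | ∃ h ∈ N, ∀ᵐ t ∂haarAddCircle, f t = starRingEnd ℂ (h t)}
  add_mem' := by
    rintro f f' ⟨h, hh, e⟩ ⟨h', hh', e'⟩
    refine ⟨h + h', N.add_mem hh hh', ?_⟩
    filter_upwards [e, e', Lp.coeFn_add f f', Lp.coeFn_add h h'] with t a b c d
    rw [c, d, Pi.add_apply, Pi.add_apply, a, b, map_add]
  zero_mem' := by
    refine ⟨0, N.zero_mem, ?_⟩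
    filter_upwards [Lp.coeFn_zero ℂ 2 (haarAddCircle (T := (1 : ℝ)))] with t a
    rw [a, Pi.zero_apply, map_zero]
  smul_mem' := by
    rintro c f ⟨h, hh, e⟩
    refine ⟨starRingEnd ℂ c • h, N.smul_mem _ hh, ?_⟩
    filter_upwards [e, Lp.coeFn_smul c f, Lp.coeFn_smul (starRingEnd ℂ c) h] with t a b d
    rw [b, d, Pi.smul_apply, Pi.smul_apply, a, smul_eq_mul, smul_eq_mul, map_mul,
      Complex.conj_conj]

/-- The model space `K_θ = H² ⊖ θH²`. -/
def modelSpace (θ : L2) : Submodule ℂ L2 := H2 ⊓ (mulSpace θ H2)ᗮ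

/-- Multiplication by `z` on `L²(𝕋)`. -/
def mulZ : L2 →L[ℂ] L2 :=
  (ContinuousLinearMap.mul ℂ ℂ).holderL haarAddCircle ⊤ 2 2 (fourierLp ⊤ 1)

/-- The dual of the compressed shift, `U_θ h = (I - P_θ)(zh)` on `K_θ^⊥`; the operator `I - P_θ`
is the orthogonal projection onto `K_θ^⊥`. -/
def dualShift (θ : L2) : (modelSpace θ)ᗮ →L[ℂ] (modelSpace θ)ᗮ :=
  (modelSpace θ)ᗮ.orthogonalProjectionOnto ∘L mulZ ∘L (modelSpace θ)ᗮ.subtypeL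

/-- A closed subspace `F` of a Hilbert space is nearly `T`-invariant if
`T (F ∩ T* H) ⊆ F`. -/
def NearlyInvariant {H : Type*} [NormedAddCommGroup H] [InnerProductSpace ℂ H] [CompleteSpace H]
    (T : H →L[ℂ] H) (F : Submodule ℂ H) : Prop :=
  IsClosed (F : Set H) ∧ ∀ x ∈ F, x ∈ Set.range (ContinuousLinearMap.adjoint T) → T x ∈ F

/-- A subspace `M` of `L²(𝕋)` is a nearly `U_θ`-invariant subspace of `K_θ^⊥`. -/
def NearlyDualShiftInvariant (θ : L2) (M : Submodule ℂ L2) : Prop :=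
  M ≤ (modelSpace θ)ᗮ ∧
    NearlyInvariant (dualShift θ) (M.comap (modelSpace θ)ᗮ.subtype)

/-- `M = A ⊕ B` as an orthogonal sum. -/
def IsOrthSum (M A B : Submodule ℂ L2) : Prop := A ⟂ B ∧ M = A ⊔ B

/-- `g` is the unit vector of `M ⊖ (M ∩ {z̄}^⊥)` with `⟨g, z̄⟩` real, the sign being fixed by
`⟨g, z̄⟩ > 0`. (The inner product of Mathlib is linear in its second argument.) -/
def IsDistinguished (M : Submodule ℂ L2) (g : L2) : Prop :=
  g ∈ M ⊓ (M ⊓ (Submodule.span ℂ {(fourierLp 2 (-1) : L2)})ᗮ)ᗮ ∧ ‖g‖ = 1 ∧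
    ∃ r : ℝ, 0 < r ∧ inner ℂ (fourierLp 2 (-1) : L2) g = (r : ℂ)

/-- `A = g · conj(K_α)` for an inner function `α` and the distinguished unit vector `g` of `M`,
which belongs to `conj(H₀²)`; all the products lie in `L²(𝕋)`. -/
def IsModelPart (M A : Submodule ℂ L2) : Prop :=
  ∃ g α : L2, IsDistinguished M g ∧ g ∈ conjSpace H2zero ∧ IsInner α ∧
    (∀ h ∈ conjSpace (modelSpace α), MemLp (fun t => g t * h t) 2 haarAddCircle) ∧
    A = mulSpace g (conjSpace (modelSpace α))

/-- `A = conj(ηH²)` for an inner function `η` with a simple zero at the origin (that is,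
`η = zη₁` where `η₁` is inner and `η₁(0) ≠ 0`). -/
def IsConjInnerPart (A : Submodule ℂ L2) : Prop :=
  ∃ η : L2, IsInner η ∧ fourierCoeff η 0 = 0 ∧ fourierCoeff η 1 ≠ 0 ∧
    A = conjSpace (mulSpace η H2)

/-- `A = γθH²` for a nonconstant inner function `γ`. -/
def IsInnerMultiplePart (θ : L2) (A : Submodule ℂ L2) : Prop :=
  ∃ γ : L2, IsNonconstInner γ ∧ A = mulSpace γ (mulSpace θ H2)

end DualShift

end

/-! The space `K_θ^⊥` is the orthogonal sum of `conj(H₀²)` and `θH²`. If `f ∈ M` and `zf` stays in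
`K_θ^⊥`, then `U_θ f = zf` and `f = U_θ^*(zf)`, so near invariance gives `zf ∈ M`
(`NearlyDualShiftInvariant.zpowMul_mem`). As the two halves meet only in `0`, the condition
decouples: `M_+` is invariant under `z`, and `M_-` contains `zf` for each of its members `f ⟂ z̄`.

For `M_+`, Beurling's theorem (`exists_unimodular_of_shift_invariant`) leaves `0`, `θH²` or `γθH²`.

The conjugate `N` of `M_-` lies in `zH²` and is nearly invariant under the backward shift, so Hitt's
theorem (`exists_isometry_of_isExtremal`) applies: division by the extremal unit vector `g` maps `N`
isometrically onto a closed backward invariant subspace of `H²`. That image is either a model space,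
which gives `g K_α`, or all of `H²`; in the latter case the isometry forces `|g| = 1`, and `g` is
inner with a simple zero at the origin (`eq_mulSpace_of_isExtremal`).

The hard point in Hitt's theorem is that no norm is lost. The operator `R f = z̄(f - ⟨g, f⟩g)`
satisfies `R†R = 1 - g ⊗ g`, so the coefficients `⟨g, Rᵏf⟩` carry all of `‖f‖` exactly when `Rⁿf →
0`. This holds on the vectors `R†ʲg`, whose coefficient series have partial sums bounded in
quadratic mean uniformly on the circle, and these vectors span a dense subspace.

The forms containing `conj(H₀²)` are the case `η = z` of those containing `conj(ηH²)`, and need no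
separate treatment. -/

noncomputable section

namespace DualShift

open Filter Topology ComplexConjugate

/-! ### Uniqueness of Fourier coefficients for integrable functions. -/

section Fourier

variable {T : ℝ} [Fact (0 < T)]

/-- An integrable function is determined by its Fourier coefficients. -/
theorem ae_eq_zero_of_fourierCoeff_eq_zero {f : AddCircle T → ℂ}
    (hf : Integrable f haarAddCircle) (h : ∀ n, fourierCoeff f n = 0) :
    f =ᵐ[haarAddCircle] 0 := by
  have hint (φ : C(AddCircle T, ℂ)) : Integrable (fun t => φ t * f t) haarAddCircle :=
    hf.bdd_mul (c := ‖φ‖) φ.continuous.aestronglyMeasurable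
      (Eventually.of_forall fun t => φ.norm_coe_le_norm t)
  have key (φ : C(AddCircle T, ℂ)) : ∫ t, φ t * f t ∂haarAddCircle = 0 := by
    let Φ : C(AddCircle T, ℂ) →L[ℂ] ℂ := LinearMap.mkContinuous
      { toFun := fun φ => ∫ t, φ t * f t ∂haarAddCircle
        map_add' := fun φ ψ => by
          rw [← integral_add (hint φ) (hint ψ)]
          simp [add_mul]
        map_smul' := fun c φ => by
          simp only [ContinuousMap.smul_apply, smul_eq_mul, mul_assoc, RingHom.id_apply]
          rw [integral_const_mul] } (∫ t, ‖f t‖ ∂haarAddCircle) (fun φ => by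
          refine (norm_integral_le_integral_norm _).trans ?_
          rw [mul_comm, ← integral_const_mul]
          refine integral_mono (hint φ).norm (hf.norm.const_mul _) fun t => ?_
          simp only [norm_mul]
          gcongr
          exact φ.norm_coe_le_norm t)
    -- Integration against `f` is a continuous functional on the continuous functions that kills the
    -- monomials, hence their closed span, which is everything.
    have hle : (Submodule.span ℂ (Set.range (@fourier T))).topologicalClosure ≤
        LinearMap.ker Φ.toLinearMap := by
      refine Submodule.topologicalClosure_minimal _ ?_ Φ.isClosed_ker
      rw [Submodule.span_le]
      rintro _ ⟨n, rfl⟩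
      have := h (-n)
      simpa [fourierCoeff, Φ] using this
    rw [span_fourier_closure_eq_top] at hle
    exact hle (Submodule.mem_top (x := φ))
  -- Indicators of closed sets are bounded pointwise limits of continuous functions.
  refine ae_eq_zero_of_forall_setIntegral_isClosed_eq_zero hf fun s hs => ?_
  have hlim : Tendsto (fun n => ∫ t, ((hs.apprSeq n t : ℝ) : ℂ) * f t ∂haarAddCircle) atTop
      (𝓝 (∫ t, s.indicator f t ∂haarAddCircle)) := by
    refine tendsto_integral_of_dominated_convergence (fun t => ‖f t‖)
      (fun n => ?_) hf.norm (fun n => ?_) ?_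
    · exact (Continuous.aestronglyMeasurable (by fun_prop)).mul hf.aestronglyMeasurable
    · refine Eventually.of_forall fun t => ?_
      rw [norm_mul]
      refine mul_le_of_le_one_left (norm_nonneg _) ?_
      simpa using HasOuterApproxClosed.apprSeq_apply_le_one hs n t
    · refine Eventually.of_forall fun t => ?_
      have h1 := (tendsto_pi_nhds.1 (HasOuterApproxClosed.tendsto_apprSeq hs)) t
      have h2 := ((Complex.continuous_ofReal.comp NNReal.continuous_coe).tendsto _).comp h1
      have h3 := h2.mul_const (f t)
      have h4 : s.indicator f t =
          (Complex.ofReal ∘ NNReal.toReal) (s.indicator (fun _ => 1) t) * f t := by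
        by_cases ht : t ∈ s <;> simp [ht]
      rw [h4]
      exact h3
  have hzero (n : ℕ) : ∫ t, ((hs.apprSeq n t : ℝ) : ℂ) * f t ∂haarAddCircle = 0 :=
    key ⟨fun t => ((hs.apprSeq n t : ℝ) : ℂ), by fun_prop⟩
  simp only [hzero] at hlim
  rw [← integral_indicator hs.measurableSet]
  exact (tendsto_nhds_unique hlim tendsto_const_nhds)

end Fourier

/-! ### Coefficients as inner products; multiplication by unimodular functions and by powers of `z`.
-/

theorem fourierCoeff_eq_inner (f : L2) (n : ℤ) :
    fourierCoeff f n = inner ℂ (fourierLp 2 n : L2) f := by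
  rw [← fourierBasis_repr, HilbertBasis.repr_apply_apply, coe_fourierBasis]

theorem fourierCoeff_sub (f g : L2) (n : ℤ) :
    fourierCoeff (⇑(f - g)) n = fourierCoeff f n - fourierCoeff g n := by
  simp only [fourierCoeff_eq_inner, inner_sub_right]

theorem ext_fourierCoeff {f g : L2} (h : ∀ n, fourierCoeff f n = fourierCoeff g n) : f = g := by
  apply fourierBasis.repr.injective
  ext n
  simpa only [fourierBasis_repr] using h n

theorem inner_eq_zero_of_fourierCoeff {f g : L2}
    (h : ∀ n, fourierCoeff f n = 0 ∨ fourierCoeff g n = 0) : inner ℂ f g = 0 := by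
  rw [← (fourierBasis (T := (1 : ℝ))).tsum_inner_mul_inner f g]
  refine (tsum_congr fun n => ?_).trans tsum_zero
  rw [coe_fourierBasis]
  rcases h n with h | h
  · rw [← inner_conj_symm, ← fourierCoeff_eq_inner, h]; simp
  · rw [← fourierCoeff_eq_inner, h]; simp

theorem isClosed_hardyFrom (k : ℤ) : IsClosed (hardyFrom k : Set L2) := by
  have : (hardyFrom k : Set L2) = ⋂ n : ℤ, ⋂ _ : n < k,
      {f : L2 | inner ℂ (fourierLp 2 n : L2) f = 0} := by
    ext f
    simp only [Set.mem_iInter, Set.mem_ofPred_eq, ← fourierCoeff_eq_inner]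
    rfl
  rw [this]
  exact isClosed_iInter fun n => isClosed_iInter fun _ =>
    isClosed_eq (by fun_prop) continuous_const

/-- Multiplication by a unimodular function, as an isometry of `L²(𝕋)`. -/
def unimodularMul (φ : L2) (hφ : ∀ᵐ t ∂haarAddCircle, ‖φ t‖ = 1) : L2 →ₗᵢ[ℂ] L2 :=
  have key (f : L2) : MemLp (fun t => φ t * f t) 2 haarAddCircle :=
    (Lp.memLp f).of_le ((Lp.aestronglyMeasurable φ).mul (Lp.aestronglyMeasurable f)) (by
      filter_upwards [hφ] with t ht
      rw [norm_mul, ht, one_mul])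
  { toFun := fun f => (key f).toLp
    map_add' := fun f g => by
      refine Lp.ext ?_
      filter_upwards [(key (f + g)).coeFn_toLp, (key f).coeFn_toLp, (key g).coeFn_toLp,
        Lp.coeFn_add f g, Lp.coeFn_add (key f).toLp (key g).toLp] with t h1 h2 h3 h4 h5
      rw [h1, h5, Pi.add_apply, h2, h3, h4, Pi.add_apply, mul_add]
    map_smul' := fun c f => by
      refine Lp.ext ?_
      filter_upwards [(key (c • f)).coeFn_toLp, (key f).coeFn_toLp,
        Lp.coeFn_smul c f, Lp.coeFn_smul c (key f).toLp] with t h1 h2 h3 h4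
      rw [h1, RingHom.id_apply, h4, Pi.smul_apply, h2, h3, Pi.smul_apply, smul_eq_mul,
        smul_eq_mul, mul_left_comm]
    norm_map' := fun f => by
      change ‖(key f).toLp‖ = ‖f‖
      rw [Lp.norm_def, Lp.norm_def]
      congr 1
      refine eLpNorm_congr_norm_ae ?_
      filter_upwards [(key f).coeFn_toLp, hφ] with t h1 h2
      rw [h1, norm_mul, h2, one_mul] }

theorem coeFn_unimodularMul (φ : L2) (hφ : ∀ᵐ t ∂haarAddCircle, ‖φ t‖ = 1) (f : L2) :
    ∀ᵐ t ∂haarAddCircle, unimodularMul φ hφ f t = φ t * f t :=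
  ((Lp.memLp f).of_le ((Lp.aestronglyMeasurable φ).mul (Lp.aestronglyMeasurable f)) (by
    filter_upwards [hφ] with t ht
    rw [norm_mul, ht, one_mul]) : MemLp (fun t => φ t * f t) 2 haarAddCircle).coeFn_toLp

theorem fourier_norm_apply (n : ℤ) (t : AddCircle (1 : ℝ)) : ‖fourier n t‖ = 1 := by
  rw [fourier_apply]; exact Circle.norm_coe _

theorem coeFn_fourierLp_two (n : ℤ) :
    ∀ᵐ t ∂haarAddCircle, (fourierLp 2 n : L2) t = fourier n t :=
  coeFn_fourierLp 2 n

theorem norm_fourierLp_ae (n : ℤ) :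
    ∀ᵐ t ∂haarAddCircle, ‖(fourierLp 2 n : L2) t‖ = 1 := by
  filter_upwards [coeFn_fourierLp_two n] with t ht
  rw [ht, fourier_norm_apply]

/-- Multiplication by `z ^ n`. -/
def zpowMul (n : ℤ) : L2 →ₗᵢ[ℂ] L2 := unimodularMul (fourierLp 2 n) (norm_fourierLp_ae n)

theorem coeFn_zpowMul (n : ℤ) (f : L2) :
    ∀ᵐ t ∂haarAddCircle, zpowMul n f t = fourier n t * f t := by
  filter_upwards [coeFn_unimodularMul _ (norm_fourierLp_ae n) f, coeFn_fourierLp_two n]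
    with t h1 h2
  rw [zpowMul, h1, h2]

theorem zpowMul_zero (f : L2) : zpowMul 0 f = f := by
  refine Lp.ext ?_
  filter_upwards [coeFn_zpowMul 0 f] with t h
  rw [h, fourier_zero, one_mul]

theorem zpowMul_zpowMul (m n : ℤ) (f : L2) : zpowMul m (zpowMul n f) = zpowMul (m + n) f := by
  refine Lp.ext ?_
  filter_upwards [coeFn_zpowMul m (zpowMul n f), coeFn_zpowMul n f, coeFn_zpowMul (m + n) f]
    with t h1 h2 h3
  rw [h1, h2, h3, fourier_add, mul_assoc]

theorem zpowMul_fourierLp (m n : ℤ) :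
    zpowMul m (fourierLp 2 n : L2) = fourierLp 2 (m + n) := by
  refine Lp.ext ?_
  filter_upwards [coeFn_zpowMul m (fourierLp 2 n : L2), coeFn_fourierLp_two n,
    coeFn_fourierLp_two (m + n)] with t h1 h2 h3
  rw [h1, h2, h3, fourier_add]

theorem unimodularMul_zpowMul (φ : L2) (hφ : ∀ᵐ t ∂haarAddCircle, ‖φ t‖ = 1) (n : ℤ) (f : L2) :
    unimodularMul φ hφ (zpowMul n f) = zpowMul n (unimodularMul φ hφ f) := by
  refine Lp.ext ?_
  filter_upwards [coeFn_unimodularMul φ hφ (zpowMul n f), coeFn_zpowMul n f,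
    coeFn_zpowMul n (unimodularMul φ hφ f), coeFn_unimodularMul φ hφ f] with t h1 h2 h3 h4
  rw [h1, h2, h3, h4, mul_left_comm]

theorem unimodularMul_fourierLp (φ : L2) (hφ : ∀ᵐ t ∂haarAddCircle, ‖φ t‖ = 1) (n : ℤ) :
    unimodularMul φ hφ (fourierLp 2 n) = zpowMul n φ := by
  refine Lp.ext ?_
  filter_upwards [coeFn_unimodularMul φ hφ (fourierLp 2 n), coeFn_zpowMul n φ,
    coeFn_fourierLp_two n] with t h1 h2 h3
  rw [h1, h2, h3, mul_comm]

theorem inner_zpowMul_left (n : ℤ) (f g : L2) :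
    inner ℂ (zpowMul n f) g = inner ℂ f (zpowMul (-n) g) := by
  rw [← (zpowMul (-n)).inner_map_map, zpowMul_zpowMul, neg_add_cancel, zpowMul_zero]

theorem fourierCoeff_zpowMul (m n : ℤ) (f : L2) :
    fourierCoeff (zpowMul m f) n = fourierCoeff f (n - m) := by
  rw [fourierCoeff_eq_inner, fourierCoeff_eq_inner, ← neg_neg m, ← inner_zpowMul_left,
    zpowMul_fourierLp]
  congr 2
  ring_nf

theorem zpowMul_mem_hardyFrom {k : ℤ} (m : ℤ) {f : L2} (hf : f ∈ hardyFrom k) :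
    zpowMul m f ∈ hardyFrom (k + m) := fun n hn => by
  rw [fourierCoeff_zpowMul]
  exact hf _ (by omega)

theorem hardyFrom_mono {j k : ℤ} (h : j ≤ k) : hardyFrom k ≤ hardyFrom j :=
  fun _ hf n hn => hf n (hn.trans_le h)

theorem eq_zero_of_forall_mem_hardyFrom {f : L2} (h : ∀ n : ℕ, f ∈ hardyFrom n) : f = 0 :=
  ext_fourierCoeff fun n => by
    rw [fourierCoeff_zero]
    exact h (n.toNat + 1) n (by push_cast; omega)

theorem norm_star_ae {φ : L2} (hφ : ∀ᵐ t ∂haarAddCircle, ‖φ t‖ = 1) :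
    ∀ᵐ t ∂haarAddCircle, ‖(star φ : L2) t‖ = 1 := by
  filter_upwards [hφ, Lp.coeFn_star φ] with t h1 h2
  rw [h2, Pi.star_apply, norm_star, h1]

theorem unimodularMul_unimodularMul_star (φ : L2) (hφ : ∀ᵐ t ∂haarAddCircle, ‖φ t‖ = 1) (f : L2) :
    unimodularMul φ hφ (unimodularMul (star φ) (norm_star_ae hφ) f) = f := by
  refine Lp.ext ?_
  filter_upwards [coeFn_unimodularMul φ hφ (unimodularMul (star φ) (norm_star_ae hφ) f),
    coeFn_unimodularMul (star φ) (norm_star_ae hφ) f, hφ, Lp.coeFn_star φ] with t h1 h2 h3 h4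
  rw [h1, h2, h4, Pi.star_apply, ← mul_assoc, RCLike.star_def, Complex.mul_conj,
    Complex.normSq_eq_norm_sq, h3]
  simp

theorem inner_unimodularMul_left (φ : L2) (hφ : ∀ᵐ t ∂haarAddCircle, ‖φ t‖ = 1) (f g : L2) :
    inner ℂ (unimodularMul φ hφ f) g = inner ℂ f (unimodularMul (star φ) (norm_star_ae hφ) g) := by
  conv_lhs => rw [← unimodularMul_unimodularMul_star φ hφ g]
  exact (unimodularMul φ hφ).inner_map_map _ _

theorem mem_mulSpace_iff {φ : L2} (hφ : ∀ᵐ t ∂haarAddCircle, ‖φ t‖ = 1) {N : Submodule ℂ L2}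
    {f : L2} : f ∈ mulSpace φ N ↔ ∃ h ∈ N, f = unimodularMul φ hφ h := by
  constructor <;> rintro ⟨h, hh, e⟩ <;> refine ⟨h, hh, ?_⟩
  · refine Lp.ext ?_
    filter_upwards [e, coeFn_unimodularMul φ hφ h] with t h1 h2
    rw [h1, h2]
  · rw [e]
    exact coeFn_unimodularMul φ hφ h

/-! ### Wandering vectors and Beurling's theorem. -/

/-- The coefficients of `|φ|²` are the inner products `⟨z ^ n φ, φ⟩`; if they are those of the
constant `1`, then `φ` is unimodular. -/
theorem unimodular_of_inner_zpowMul {φ : L2} (h1 : ‖φ‖ = 1)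
    (h : ∀ n : ℕ, 0 < n → inner ℂ φ (zpowMul n φ) = 0) : ∀ᵐ t ∂haarAddCircle, ‖φ t‖ = 1 := by
  have hi : Integrable (fun t => inner ℂ (φ t) (φ t)) haarAddCircle := L2.integrable_inner φ φ
  have hcoeff (n : ℤ) : fourierCoeff (fun t => inner ℂ (φ t) (φ t) : AddCircle (1 : ℝ) → ℂ) n =
      inner ℂ (zpowMul n φ) φ := by
    rw [fourierCoeff, L2.inner_def]
    refine integral_congr_ae ?_
    filter_upwards [coeFn_zpowMul n φ] with t ht
    rw [ht, fourier_neg, smul_eq_mul, RCLike.inner_apply, RCLike.inner_apply, map_mul]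
    ring
  have hoff (n : ℤ) (hn : n ≠ 0) : inner ℂ (zpowMul n φ) φ = 0 := by
    rcases lt_or_gt_of_ne hn with hn | hn
    · have := h (-n).toNat (by omega)
      rwa [inner_zpowMul_left, ← Int.toNat_of_nonneg (a := -n) (by omega)]
    · have := h n.toNat (by omega)
      rw [Int.toNat_of_nonneg hn.le] at this
      rw [← inner_conj_symm, this, map_zero]
  have hz : (fun t => inner ℂ (φ t) (φ t) - fourier 0 t : AddCircle (1 : ℝ) → ℂ)
      =ᵐ[haarAddCircle] 0 := by
    have hi0 : Integrable (fun t => fourier 0 t : AddCircle (1 : ℝ) → ℂ) haarAddCircle :=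
      (map_continuous (fourier 0)).integrable_of_hasCompactSupport
        (HasCompactSupport.of_compactSpace _)
    refine ae_eq_zero_of_fourierCoeff_eq_zero (hi.sub hi0) fun n => ?_
    have hs : fourierCoeff (fun t => inner ℂ (φ t) (φ t) - fourier 0 t : AddCircle (1 : ℝ) → ℂ) n =
        fourierCoeff (fun t => inner ℂ (φ t) (φ t) : AddCircle (1 : ℝ) → ℂ) n -
          fourierCoeff (fourier 0 : AddCircle (1 : ℝ) → ℂ) n := by
      simp only [fourierCoeff, smul_sub]
      exact integral_sub (hi.fourier_smul _) (hi0.fourier_smul _)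
    rw [hs, hcoeff, fourierCoeff_fourier]
    rcases eq_or_ne n 0 with rfl | hn
    · simp [zpowMul_zero, inner_self_eq_norm_sq_to_K, h1]
    · simp [hoff n hn, hn]
  filter_upwards [hz] with t ht
  have : inner ℂ (φ t) (φ t) - fourier 0 t = (0 : ℂ) := ht
  rw [fourier_zero, inner_self_eq_norm_sq_to_K, sub_eq_zero] at this
  have h2 : ‖φ t‖ ^ 2 = 1 := Complex.ofReal_injective (by simpa using this)
  exact (pow_eq_one_iff_of_nonneg (norm_nonneg _) two_ne_zero).1 h2

/-- Beurling's theorem. -/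
theorem exists_unimodular_of_shift_invariant {E : Submodule ℂ L2} (hcl : IsClosed (E : Set L2))
    (hle : E ≤ H2) (hz : ∀ f ∈ E, zpowMul 1 f ∈ E) (hne : E ≠ ⊥) :
    ∃ φ ∈ E, (∀ᵐ t ∂haarAddCircle, ‖φ t‖ = 1) ∧ E = mulSpace φ H2 := by
  let F : Submodule ℂ L2 := E.map (zpowMul 1).toLinearMap
  have hFE : F ≤ E := by
    rintro _ ⟨f, hf, rfl⟩
    exact hz f hf
  have : CompleteSpace E := hcl.completeSpace_coe
  have hFc : IsClosed (F : Set L2) :=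
    (zpowMul 1).isometry.isClosedEmbedding.isClosedMap _ hcl
  have : CompleteSpace F := hFc.completeSpace_coe
  have hzn (n : ℕ) (f : L2) (hf : f ∈ E) : zpowMul n f ∈ E := by
    induction n with
    | zero => simpa [zpowMul_zero] using hf
    | succ n ih =>
      have := hz _ ih
      rw [zpowMul_zpowMul] at this
      convert this using 2
      push_cast; ring_nf
  have hw : ∃ φ ∈ E, φ ∈ Fᗮ ∧ ‖φ‖ = 1 := by
    by_contra! hcon
    have hbot : Fᗮ ⊓ E = ⊥ := by
      rw [Submodule.eq_bot_iff]
      rintro f ⟨hf1, hf2⟩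
      by_contra hf0
      refine hcon ((‖f‖⁻¹ : ℂ) • f) (E.smul_mem _ hf2) (Fᗮ.smul_mem _ hf1) ?_
      exact norm_smul_inv_norm hf0
    have hEF : F = E := by
      have := Submodule.sup_orthogonal_inf_of_hasOrthogonalProjection hFE
      rwa [hbot, sup_bot_eq] at this
    -- Without a wandering vector `zE = E`, so `E` lies in every `zⁿH²`, and these intersect in `0`.
    have hall (n : ℕ) : E ≤ hardyFrom n := by
      induction n with
      | zero => exact hle
      | succ n ih =>
        rw [← hEF]
        rintro _ ⟨f, hf, rfl⟩
        exact_mod_cast zpowMul_mem_hardyFrom 1 (ih hf)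
    exact hne ((Submodule.eq_bot_iff _).2 fun f hf =>
      eq_zero_of_forall_mem_hardyFrom fun n => hall n hf)
  obtain ⟨φ, hφE, hφF, hφ1⟩ := hw
  have horth (n : ℕ) (hn : 0 < n) (f : L2) (hf : f ∈ E) : inner ℂ φ (zpowMul n f) = 0 := by
    refine Submodule.inner_left_of_mem_orthogonal ?_ hφF
    refine ⟨zpowMul (n - 1 : ℕ) f, hzn _ f hf, ?_⟩
    change zpowMul 1 _ = _
    rw [zpowMul_zpowMul]
    congr 2
    omega
  have hφu := unimodular_of_inner_zpowMul hφ1 fun n hn => horth n hn φ hφE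
  -- The `n`-th coefficient of `φ̄f` is `⟨zⁿφ, f⟩`. It vanishes for `n < 0` if `f ∈ E`, which puts
  -- `φ̄f` in `H²`; it vanishes for `n ≥ 0` if `f ⟂ E`, which makes `f` orthogonal to `φH²`.
  refine ⟨φ, hφE, hφu, le_antisymm (fun f hf => ?_) fun f hf => ?_⟩
  · rw [mem_mulSpace_iff hφu]
    refine ⟨unimodularMul (star φ) (norm_star_ae hφu) f, fun n hn => ?_,
      (unimodularMul_unimodularMul_star φ hφu f).symm⟩
    rw [fourierCoeff_eq_inner, ← inner_unimodularMul_left φ hφu, unimodularMul_fourierLp,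
      inner_zpowMul_left]
    have := horth (-n).toNat (by omega) f hf
    rwa [Int.toNat_of_nonneg (by omega)] at this
  · obtain ⟨h, hh, rfl⟩ := (mem_mulSpace_iff hφu).1 hf
    rw [← Submodule.orthogonal_orthogonal E, Submodule.mem_orthogonal']
    intro u hu
    rw [inner_unimodularMul_left]
    refine inner_eq_zero_of_fourierCoeff fun n => ?_
    rcases lt_or_ge n 0 with hn | hn
    · exact Or.inl (hh n hn)
    · right
      rw [fourierCoeff_eq_inner, ← inner_unimodularMul_left φ hφu, unimodularMul_fourierLp]
      have := hzn n.toNat φ hφE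
      rw [Int.toNat_of_nonneg hn] at this
      exact Submodule.inner_right_of_mem_orthogonal this hu

/-! ### Contractions with one-dimensional defect. -/

theorem pow_succ_apply {H : Type*} [NormedAddCommGroup H] [InnerProductSpace ℂ H]
    (R : H →L[ℂ] H) (n : ℕ) (x : H) : (R ^ (n + 1)) x = R ((R ^ n) x) := by
  rw [pow_succ']; rfl

section DefectOne

variable {H : Type*} [NormedAddCommGroup H] [InnerProductSpace ℂ H] [CompleteSpace H]

/-- The vectors representing the partial sums `x ↦ ∑ k ≤ n, ⟨g, R ^ k x⟩ ω ^ k`. -/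
def partialSumVec (R : H →L[ℂ] H) (g : H) (ω : ℂ) : ℕ → H
  | 0 => g
  | n + 1 => g + conj ω • R.adjoint (partialSumVec R g ω n)

theorem inner_partialSumVec (R : H →L[ℂ] H) (g : H) (ω : ℂ) (n : ℕ) (x : H) :
    inner ℂ (partialSumVec R g ω n) x =
      ∑ k ∈ Finset.range (n + 1), inner ℂ g ((R ^ k) x) * ω ^ k := by
  induction n generalizing x with
  | zero => simp [partialSumVec]
  | succ n ih =>
    rw [partialSumVec, inner_add_left, inner_smul_left, Complex.conj_conj,
      ContinuousLinearMap.adjoint_inner_left, ih, Finset.sum_range_succ' _ (n + 1), Finset.mul_sum,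
      add_comm]
    congr 1
    · refine Finset.sum_congr rfl fun k _ => ?_
      rw [pow_succ R, pow_succ ω]
      change ω * (inner ℂ g ((R ^ k) (R x)) * ω ^ k) = inner ℂ g ((R ^ k) (R x)) * _
      ring
    · simp

/-- The partial sums of the coefficient series of `x` are square summable in the mean, uniformly
on the circle. -/
def HasBoundedMeans (R : H →L[ℂ] H) (g x : H) : Prop :=
  ∃ K : ℝ, ∀ ω : ℂ, ‖ω‖ = 1 → ∀ m : ℕ,
    ∑ n ∈ Finset.range m, ‖inner ℂ (partialSumVec R g ω n) x‖ ^ 2 ≤ K * m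

/-- `R` is a contraction with one-dimensional defect: `R† R = 1 - g ⊗ g` for a unit vector `g`
in the kernel of `R`. -/
structure IsDefectOne (R : H →L[ℂ] H) (g : H) : Prop where
  norm_eq : ‖g‖ = 1
  map_eq : R g = 0
  adjoint_map : ∀ f, R.adjoint (R f) = f - inner ℂ g f • g

namespace IsDefectOne

variable {R : H →L[ℂ] H} {g : H}

theorem norm_sq_map (hR : IsDefectOne R g) (f : H) : ‖R f‖ ^ 2 = ‖f‖ ^ 2 - ‖inner ℂ g f‖ ^ 2 := by
  have h : inner ℂ (R f) (R f) = inner ℂ f f - inner ℂ g f * inner ℂ f g := by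
    rw [← ContinuousLinearMap.adjoint_inner_right, hR.adjoint_map, inner_sub_right,
      inner_smul_right]
  rw [← inner_conj_symm f g, Complex.mul_conj, Complex.normSq_eq_norm_sq,
    inner_self_eq_norm_sq_to_K, inner_self_eq_norm_sq_to_K] at h
  apply Complex.ofReal_injective
  push_cast
  simpa using h

theorem norm_map_le (hR : IsDefectOne R g) (f : H) : ‖R f‖ ≤ ‖f‖ := by
  have := hR.norm_sq_map f
  exact le_of_sq_le_sq (by nlinarith [sq_nonneg ‖(inner ℂ g f : ℂ)‖]) (norm_nonneg _)

theorem inner_adjoint (hR : IsDefectOne R g) (f : H) : inner ℂ g (R.adjoint f) = 0 := by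
  rw [ContinuousLinearMap.adjoint_inner_right, hR.map_eq, inner_zero_left]

/-- The range of `R†` is orthogonal to `g`, and `R` is isometric there. -/
theorem norm_sq_sub (hR : IsDefectOne R g) (v : H) :
    ‖v - R (R.adjoint v)‖ ^ 2 = ‖v‖ ^ 2 - ‖R.adjoint v‖ ^ 2 := by
  have h1 : ‖R (R.adjoint v)‖ ^ 2 = ‖R.adjoint v‖ ^ 2 := by
    rw [hR.norm_sq_map, hR.inner_adjoint]; simp
  have h2 : inner ℂ v (R (R.adjoint v)) = ((‖R.adjoint v‖ ^ 2 : ℝ) : ℂ) := by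
    rw [← ContinuousLinearMap.adjoint_inner_left, inner_self_eq_norm_sq_to_K]
    simp
  rw [@norm_sub_sq ℂ, h1, h2]
  simp only [RCLike.re_to_complex, Complex.ofReal_re]
  ring

theorem norm_inner_sub_map_adjoint_le (R : H →L[ℂ] H) (f v : H) :
    ‖inner ℂ v (f - R (R.adjoint f))‖ ≤ ‖f‖ * ‖v - R (R.adjoint v)‖ := by
  have h : inner ℂ v (f - R (R.adjoint f)) = inner ℂ (v - R (R.adjoint v)) f := by
    rw [inner_sub_right, inner_sub_left, ← ContinuousLinearMap.adjoint_inner_left R,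
      ContinuousLinearMap.adjoint_inner_right R]
  rw [h, mul_comm]
  exact norm_inner_le_norm _ _

theorem norm_sq_partialSumVec_succ (hR : IsDefectOne R g) {ω : ℂ} (hω : ‖ω‖ = 1) (n : ℕ) :
    ‖partialSumVec R g ω (n + 1)‖ ^ 2 = 1 + ‖R.adjoint (partialSumVec R g ω n)‖ ^ 2 := by
  rw [partialSumVec, @norm_add_sq ℂ, inner_smul_right, hR.inner_adjoint, norm_smul, hR.norm_eq]
  simp [hω]

/-- Each summand is `‖yₙ‖² - ‖R†yₙ‖² = ‖yₙ‖² - ‖yₙ₊₁‖² + 1` for the partial sum vectors `yₙ`, so the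
sum telescopes to `m + 1 - ‖yₘ‖²`, and `‖yₘ‖ ≥ 1`. -/
theorem sum_norm_sq_sub_le (hR : IsDefectOne R g) {ω : ℂ} (hω : ‖ω‖ = 1) (m : ℕ) :
    ∑ n ∈ Finset.range m, ‖partialSumVec R g ω n - R (R.adjoint (partialSumVec R g ω n))‖ ^ 2
      ≤ m := by
  have key : ∑ n ∈ Finset.range m,
      ‖partialSumVec R g ω n - R (R.adjoint (partialSumVec R g ω n))‖ ^ 2
      = m + 1 - ‖partialSumVec R g ω m‖ ^ 2 := by
    induction m with
    | zero => simp [partialSumVec, hR.norm_eq]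
    | succ m ih =>
      rw [Finset.sum_range_succ, ih, hR.norm_sq_sub, hR.norm_sq_partialSumVec_succ hω]
      push_cast
      ring
  have h1 : 1 ≤ ‖partialSumVec R g ω m‖ ^ 2 := by
    cases m with
    | zero => simp [partialSumVec, hR.norm_eq]
    | succ m =>
      rw [hR.norm_sq_partialSumVec_succ hω]
      nlinarith [sq_nonneg ‖R.adjoint (partialSumVec R g ω m)‖]
  linarith

theorem hasBoundedMeans_self (hR : IsDefectOne R g) : HasBoundedMeans R g g := by
  refine ⟨1, fun ω hω m => ?_⟩
  have (n : ℕ) : inner ℂ (partialSumVec R g ω n) g = 1 := by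
    rw [← inner_conj_symm]
    cases n with
    | zero => simp [partialSumVec, inner_self_eq_norm_sq_to_K, hR.norm_eq]
    | succ n =>
      rw [partialSumVec, inner_add_right, inner_smul_right, hR.inner_adjoint]
      simp [inner_self_eq_norm_sq_to_K, hR.norm_eq]
  simp [this]

/-- Since `yₙ₊₁ = g + ω̄ R†yₙ` and `g ⟂ R†x`, the new partial sum is `ω⟨yₙ, RR†x⟩`. It differs from
`ω⟨yₙ, x⟩` by at most `‖x‖ ‖yₙ - RR†yₙ‖`, whose squares have bounded mean by `sum_norm_sq_sub_le`.
-/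
theorem hasBoundedMeans_adjoint (hR : IsDefectOne R g) {x : H} (hx : HasBoundedMeans R g x) :
    HasBoundedMeans R g (R.adjoint x) := by
  obtain ⟨K, hK⟩ := hx
  refine ⟨2 * K + 2 * ‖x‖ ^ 2, fun ω hω m => ?_⟩
  have hstep (n : ℕ) : ‖inner ℂ (partialSumVec R g ω (n + 1)) (R.adjoint x)‖ ^ 2 ≤
      2 * ‖inner ℂ (partialSumVec R g ω n) x‖ ^ 2 +
        2 * (‖x‖ ^ 2 * ‖partialSumVec R g ω n - R (R.adjoint (partialSumVec R g ω n))‖ ^ 2) := by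
    set y := partialSumVec R g ω n with hy
    have e : inner ℂ (partialSumVec R g ω (n + 1)) (R.adjoint x) =
        ω * (inner ℂ y x - inner ℂ y (x - R (R.adjoint x))) := by
      rw [partialSumVec, inner_add_left, hR.inner_adjoint, zero_add, inner_smul_left,
        Complex.conj_conj, ContinuousLinearMap.adjoint_inner_left, inner_sub_right, sub_sub_cancel]
    have h1 := norm_inner_sub_map_adjoint_le R x y
    rw [e, norm_mul, hω, one_mul]
    have h2 := norm_sub_le (inner ℂ y x : ℂ) (inner ℂ y (x - R (R.adjoint x)))
    have h3 : ‖(inner ℂ y x : ℂ) - inner ℂ y (x - R (R.adjoint x))‖ ≤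
        ‖(inner ℂ y x : ℂ)‖ + ‖x‖ * ‖y - R (R.adjoint y)‖ := h2.trans (by gcongr)
    calc _ ≤ (‖(inner ℂ y x : ℂ)‖ + ‖x‖ * ‖y - R (R.adjoint y)‖) ^ 2 := by gcongr
      _ ≤ _ := by
        nlinarith [sq_nonneg (‖(inner ℂ y x : ℂ)‖ - ‖x‖ * ‖y - R (R.adjoint y)‖)]
  cases m with
  | zero => simp
  | succ m =>
    rw [Finset.sum_range_succ']
    have h0 : inner ℂ (partialSumVec R g ω 0) (R.adjoint x) = 0 := hR.inner_adjoint x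
    -- The sign of `K` is not part of `HasBoundedMeans`; the case `m = 1` supplies it.
    have hK0 : 0 ≤ K := by
      have := hK ω hω 1
      simp only [Finset.range_one, Finset.sum_singleton, Nat.cast_one, mul_one] at this
      exact (sq_nonneg _).trans this
    calc _ ≤ ∑ n ∈ Finset.range m, (2 * ‖inner ℂ (partialSumVec R g ω n) x‖ ^ 2 +
        2 * (‖x‖ ^ 2 * ‖partialSumVec R g ω n - R (R.adjoint (partialSumVec R g ω n))‖ ^ 2)) := by
          rw [h0]
          simp only [norm_zero, ne_eq, OfNat.ofNat_ne_zero, not_false_eq_true, zero_pow, add_zero]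
          exact Finset.sum_le_sum fun n _ => hstep n
      _ ≤ 2 * (K * m) + 2 * (‖x‖ ^ 2 * m) := by
          rw [Finset.sum_add_distrib, ← Finset.mul_sum, ← Finset.mul_sum, ← Finset.mul_sum]
          gcongr
          · exact hK ω hω m
          · exact hR.sum_norm_sq_sub_le hω m
      _ ≤ _ := by
          push_cast
          nlinarith [sq_nonneg ‖x‖]

theorem hasBoundedMeans_adjoint_pow (hR : IsDefectOne R g) (j : ℕ) :
    HasBoundedMeans R g ((R.adjoint ^ j) g) := by
  induction j with
  | zero => exact hR.hasBoundedMeans_self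
  | succ j ih =>
    rw [pow_succ']
    exact hR.hasBoundedMeans_adjoint ih

theorem sum_norm_sq_add (hR : IsDefectOne R g) (n : ℕ) (x : H) :
    ∑ k ∈ Finset.range n, ‖inner ℂ g ((R ^ k) x)‖ ^ 2 + ‖(R ^ n) x‖ ^ 2 = ‖x‖ ^ 2 := by
  induction n with
  | zero => simp
  | succ n ih =>
    rw [Finset.sum_range_succ, pow_succ_apply, hR.norm_sq_map, ← ih]
    ring

theorem norm_pow_le (hR : IsDefectOne R g) (n : ℕ) (x : H) : ‖(R ^ n) x‖ ≤ ‖x‖ := by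
  have h := hR.sum_norm_sq_add n x
  have h2 : 0 ≤ ∑ k ∈ Finset.range n, ‖inner ℂ g ((R ^ k) x)‖ ^ 2 :=
    Finset.sum_nonneg fun _ _ => sq_nonneg _
  exact le_of_sq_le_sq (by linarith) (norm_nonneg _)

theorem antitone_norm_pow (hR : IsDefectOne R g) (x : H) : Antitone fun n => ‖(R ^ n) x‖ :=
  antitone_nat_of_succ_le fun n => by
    rw [pow_succ_apply]
    exact hR.norm_map_le _

/-- The powers of `R` are contractions, so the vectors with `Rⁿx → 0` form a closed subspace; it
contains `S`, and `hd` says that nothing nonzero is orthogonal to `S`. -/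
theorem tendsto_norm_pow_of_closure (hR : IsDefectOne R g) {S : Set H}
    (hS : ∀ x ∈ S, Tendsto (fun n => ‖(R ^ n) x‖) atTop (𝓝 0))
    (hd : ∀ f, (∀ x ∈ S, inner ℂ x f = 0) → f = 0) (x : H) :
    Tendsto (fun n => ‖(R ^ n) x‖) atTop (𝓝 0) := by
  let V : Submodule ℂ H :=
    { carrier := {x | Tendsto (fun n => ‖(R ^ n) x‖) atTop (𝓝 0)}
      zero_mem' := by simp
      add_mem' := fun {a b} ha hb => by
        have h : Tendsto (fun n => ‖(R ^ n) a‖ + ‖(R ^ n) b‖) atTop (𝓝 (0 + 0)) :=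
          Tendsto.add ha hb
        rw [add_zero] at h
        refine squeeze_zero (fun _ => norm_nonneg _) (fun n => ?_) h
        rw [map_add]
        exact norm_add_le _ _
      smul_mem' := fun c a ha => by
        have : Tendsto (fun n => ‖c‖ * ‖(R ^ n) a‖) atTop (𝓝 (‖c‖ * 0)) := ha.const_mul _
        simpa only [Set.mem_ofPred_eq, map_smul, norm_smul, mul_zero] using this }
  have hVcl : IsClosed (V : Set H) := by
    refine isClosed_of_closure_subset fun x hx => ?_
    change Tendsto (fun n => ‖(R ^ n) x‖) atTop (𝓝 0)
    rw [Metric.tendsto_atTop]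
    intro ε hε
    obtain ⟨y, hy, hxy⟩ := Metric.mem_closure_iff.1 hx (ε / 2) (half_pos hε)
    obtain ⟨N, hN⟩ := (Metric.tendsto_atTop.1 (show Tendsto _ _ _ from hy)) (ε / 2) (half_pos hε)
    refine ⟨N, fun n hn => ?_⟩
    have h1 := hN n hn
    rw [dist_zero_right, norm_norm] at h1 ⊢
    rw [dist_eq_norm] at hxy
    calc ‖(R ^ n) x‖ = ‖(R ^ n) (x - y) + (R ^ n) y‖ := by rw [← map_add, sub_add_cancel]
      _ ≤ ‖(R ^ n) (x - y)‖ + ‖(R ^ n) y‖ := norm_add_le _ _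
      _ ≤ ‖x - y‖ + ‖(R ^ n) y‖ := by gcongr; exact hR.norm_pow_le n _
      _ < ε := by linarith
  have : CompleteSpace V := hVcl.completeSpace_coe
  have hbot : Vᗮ = ⊥ := by
    rw [Submodule.eq_bot_iff]
    exact fun f hf => hd f fun x hx => (Submodule.mem_orthogonal _ _).1 hf x (hS x hx)
  have hV : V = ⊤ := (Submodule.orthogonal_eq_bot_iff).1 hbot
  exact (hV ▸ Submodule.mem_top : x ∈ V)

end IsDefectOne

end DefectOne

/-! ### Means of squares in `L²`, and Hardy functions with prescribed coefficients. -/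

theorem Lp_two_norm_sq {α : Type*} [MeasurableSpace α] {μ : Measure α} (f : Lp ℂ 2 μ) :
    ‖f‖ ^ 2 = ∫ t, ‖f t‖ ^ 2 ∂μ := by
  have h : ((‖f‖ ^ 2 : ℝ) : ℂ) = ((∫ t, ‖f t‖ ^ 2 ∂μ : ℝ) : ℂ) := by
    rw [← integral_complex_ofReal]
    have := inner_self_eq_norm_sq_to_K (𝕜 := ℂ) f
    rw [L2.inner_def] at this
    simp only [inner_self_eq_norm_sq_to_K] at this
    simpa using this.symm
  exact Complex.ofReal_injective h

theorem Lp_two_integrable_norm_sq {α : Type*} [MeasurableSpace α] {μ : Measure α}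
    (f : Lp ℂ 2 μ) : Integrable (fun t => ‖f t‖ ^ 2) μ :=
  (memLp_two_iff_integrable_sq_norm (Lp.aestronglyMeasurable f)).1 (Lp.memLp f)

/-- If `u n → 0` in `L²` and the arithmetic means of the `|g u n|²` are dominated, then
`‖g u n‖` can only converge to `0`. -/
theorem limit_eq_zero_of_dominated_means {α : Type*} [MeasurableSpace α] {μ : Measure α}
    {u y : ℕ → Lp ℂ 2 μ} {g : α → ℂ} {F : α → ℝ} {c : ℝ}
    (hu : Tendsto (fun n => ‖u n‖) atTop (𝓝 0)) (hy : ∀ n, ∀ᵐ t ∂μ, y n t = g t * u n t)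
    (hF : Integrable F μ)
    (hle : ∀ N : ℕ, ∀ᵐ t ∂μ, (N : ℝ)⁻¹ * ∑ n ∈ Finset.range N, ‖y n t‖ ^ 2 ≤ F t)
    (hc : Tendsto (fun n => ‖y n‖) atTop (𝓝 c)) : c = 0 := by
  let W (v : ℕ → Lp ℂ 2 μ) (N : ℕ) (t : α) : ℝ := (N : ℝ)⁻¹ * ∑ n ∈ Finset.range N, ‖v n t‖ ^ 2
  have hWi (v : ℕ → Lp ℂ 2 μ) (N : ℕ) : Integrable (W v N) μ :=
    (integrable_finsetSum _ fun n _ => Lp_two_integrable_norm_sq (v n)).const_mul _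
  have hWint (v : ℕ → Lp ℂ 2 μ) (N : ℕ) :
      ∫ t, W v N t ∂μ = (N : ℝ)⁻¹ * ∑ n ∈ Finset.range N, ‖v n‖ ^ 2 := by
    simp only [W, Lp_two_norm_sq]
    rw [integral_const_mul, integral_finsetSum _ fun n _ => Lp_two_integrable_norm_sq (v n)]
  have hW0 (v : ℕ → Lp ℂ 2 μ) (N : ℕ) (t : α) : 0 ≤ W v N t := by positivity
  have hmean : Tendsto (fun N => ∫ t, W u N t ∂μ) atTop (𝓝 0) := by
    simp only [hWint]
    have := (hu.pow 2).cesaro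
    simpa using this
  have hmeas : TendstoInMeasure μ (W u) atTop (fun _ => 0) := by
    refine tendstoInMeasure_of_tendsto_eLpNorm one_ne_zero
      (fun N => (hWi u N).aestronglyMeasurable) aestronglyMeasurable_const ?_
    have he (N : ℕ) : eLpNorm (W u N - fun _ => 0) 1 μ = ENNReal.ofReal (∫ t, W u N t ∂μ) := by
      rw [eLpNorm_one_eq_lintegral_enorm, ofReal_integral_eq_lintegral_ofReal (hWi u N)
        (Eventually.of_forall (hW0 u N))]
      refine lintegral_congr fun t => ?_
      simp only [Pi.sub_apply, sub_zero]
      rw [Real.enorm_eq_ofReal (hW0 u N t)]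
    simp only [he]
    have := ENNReal.tendsto_ofReal hmean
    simpa using this
  -- Although `g` may be unbounded, almost everywhere convergence of the means of `|u n|²` survives
  -- the factor `|g t|²`; domination by `F` then lets the integrals converge too.
  obtain ⟨ns, hns, hae⟩ := hmeas.exists_seq_tendsto_ae
  have hlim0 : Tendsto (fun i => ∫ t, W y (ns i) t ∂μ) atTop (𝓝 (∫ _, (0 : ℝ) ∂μ)) := by
    refine tendsto_integral_of_dominated_convergence F
      (fun i => (hWi y (ns i)).aestronglyMeasurable) hF (fun i => ?_) ?_
    · filter_upwards [hle (ns i)] with t ht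
      rw [Real.norm_of_nonneg (hW0 y (ns i) t)]
      exact ht
    · filter_upwards [hae, ae_all_iff.2 hy] with t h1 h2
      have : (fun i => W y (ns i) t) = fun i => ‖g t‖ ^ 2 * W u (ns i) t := by
        funext i
        simp only [W, h2, norm_mul, mul_pow, ← Finset.mul_sum]
        ring
      rw [this]
      simpa using h1.const_mul (‖g t‖ ^ 2)
  have hlimc : Tendsto (fun i => ∫ t, W y (ns i) t ∂μ) atTop (𝓝 (c ^ 2)) := by
    simp only [hWint]
    exact (hc.pow 2).cesaro.comp hns.tendsto_atTop
  have := tendsto_nhds_unique hlimc hlim0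
  simpa using this

/-- The function in the Hardy space with given square summable coefficients. -/
theorem exists_hardy_of_summable {a : ℕ → ℂ} (ha : Summable fun n => ‖a n‖ ^ 2) :
    ∃ h ∈ H2, ∀ n : ℕ, fourierCoeff (h : L2) n = a n := by
  let b : ℤ → ℂ := fun n => if 0 ≤ n then a n.toNat else 0
  have hb : Memℓp b 2 := by
    refine memℓp_gen ?_
    have : Summable fun n : ℤ => ‖b n‖ ^ 2 := by
      refine (Function.Injective.summable_iff (g := ((↑) : ℕ → ℤ)) Nat.cast_injective ?_).1 ?_
      · intro n hn
        have : ¬ 0 ≤ n := fun h => hn ⟨n.toNat, Int.toNat_of_nonneg h⟩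
        simp [b, this]
      · simpa [Function.comp_def, b] using ha
    simpa using this
  refine ⟨fourierBasis.repr.symm ⟨b, hb⟩, fun n hn => ?_, fun n => ?_⟩
  · rw [← fourierBasis_repr, LinearIsometryEquiv.apply_symm_apply]
    exact if_neg (by omega)
  · rw [← fourierBasis_repr, LinearIsometryEquiv.apply_symm_apply]
    change (if 0 ≤ (n : ℤ) then a (n : ℤ).toNat else 0) = a n
    simp

theorem tendsto_partialSum {h : L2} (hh : h ∈ H2) :
    Tendsto (fun n => ∑ k ∈ Finset.range n, fourierCoeff h k • (fourierLp 2 (k : ℤ) : L2))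
      atTop (𝓝 h) := by
  have h1 := hasSum_fourier_series_L2 h
  rw [← Function.Injective.hasSum_iff (g := ((↑) : ℕ → ℤ)) Nat.cast_injective] at h1
  · exact h1.tendsto_sum_nat
  · intro n hn
    have : ¬ 0 ≤ n := fun h => hn ⟨n.toNat, Int.toNat_of_nonneg h⟩
    rw [hh n (by omega), zero_smul]

theorem hasSum_norm_sq_fourierCoeff {h : L2} (hh : h ∈ H2) :
    HasSum (fun n : ℕ => ‖fourierCoeff h n‖ ^ 2) (‖h‖ ^ 2) := by
  have h1 := hasSum_sq_fourierCoeff h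
  rw [← Lp_two_norm_sq, ← Function.Injective.hasSum_iff (g := ((↑) : ℕ → ℤ)) Nat.cast_injective]
    at h1
  · exact h1
  · intro n hn
    have : ¬ 0 ≤ n := fun h => hn ⟨n.toNat, Int.toNat_of_nonneg h⟩
    rw [hh n (by omega), norm_zero, zero_pow two_ne_zero]

/-- The product `gu` is merely integrable, but this makes each of its coefficients a continuous
function of `u ∈ L²`. -/
theorem fourierCoeff_mul_eq_inner (g u : L2) (m : ℤ) :
    fourierCoeff (fun t => g t * u t : AddCircle (1 : ℝ) → ℂ) m =
      inner ℂ (star (zpowMul (-m) g)) u := by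
  rw [fourierCoeff, L2.inner_def]
  refine integral_congr_ae ?_
  filter_upwards [coeFn_zpowMul (-m) g, Lp.coeFn_star (zpowMul (-m) g)] with t h1 h2
  rw [h2, Pi.star_apply, h1, RCLike.inner_apply, RCLike.star_def, Complex.conj_conj, smul_eq_mul]
  ring

theorem fourier_natCast (n : ℕ) (t : AddCircle (1 : ℝ)) : fourier (n : ℤ) t = fourier 1 t ^ n := by
  induction n with
  | zero => simp
  | succ n ih => rw [Nat.cast_succ, fourier_add, ih, pow_succ]

theorem coeFn_sum_smul_zpowMul (a : ℕ → ℂ) (g : L2) (n : ℕ) :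
    ∀ᵐ t ∂haarAddCircle, (∑ k ∈ Finset.range n, a k • zpowMul k g : L2) t =
      g t * ∑ k ∈ Finset.range n, a k * fourier 1 t ^ k := by
  induction n with
  | zero =>
    filter_upwards with t
    simp
  | succ n ih =>
    rw [Finset.sum_range_succ]
    filter_upwards [ih, Lp.coeFn_add (∑ k ∈ Finset.range n, a k • zpowMul k g : L2)
      (a n • zpowMul n g), Lp.coeFn_smul (a n) (zpowMul n g), coeFn_zpowMul n g]
      with t h1 h2 h3 h4
    rw [h2, Pi.add_apply, h1, h3, Pi.smul_apply, h4, Finset.sum_range_succ, smul_eq_mul, fourier_natCast]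
    ring

theorem fourierCoeff_fourierLp (m n : ℤ) :
    fourierCoeff (fourierLp 2 m : L2) n = if n = m then 1 else 0 := by
  rw [congrFun (fourierCoeff_congr_ae (coeFn_fourierLp 2 m)) n, fourierCoeff_fourier,
    Pi.single_apply]

/-! ### Nearly backward invariant subspaces and Hitt's theorem. -/

/-- A closed subspace `N` of `zH²` that contains `z̄f` for each `f ∈ N` vanishing to second order
at the origin; equivalently, `z̄N` is nearly invariant under the backward shift. -/
structure IsNearlyBackwardInvariant (N : Submodule ℂ L2) : Prop where
  isClosed : IsClosed (N : Set L2)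
  le : N ≤ H2zero
  backward : ∀ f ∈ N, fourierCoeff f 1 = 0 → zpowMul (-1) f ∈ N

/-- `g` is a unit vector of `N` that represents a positive multiple of the functional
`f ↦ fourierCoeff f 1`. -/
structure IsExtremal (N : Submodule ℂ L2) (g : L2) : Prop where
  mem : g ∈ N
  norm_eq : ‖g‖ = 1
  exists_coeff : ∃ r : ℝ, 0 < r ∧ ∀ f ∈ N, fourierCoeff f 1 = r * inner ℂ g f

theorem IsNearlyBackwardInvariant.exists_isExtremal {N : Submodule ℂ L2}
    (hN : IsNearlyBackwardInvariant N) (hne : N ≠ ⊥) : ∃ g, IsExtremal N g := by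
  have : CompleteSpace N := hN.isClosed.completeSpace_coe
  -- If the first coefficient vanished on all of `N`, division by `z` could be repeated forever and
  -- every coefficient would vanish.
  have hex : ∃ f ∈ N, fourierCoeff f 1 ≠ 0 := by
    by_contra! hcon
    have hall (k : ℕ) : ∀ f ∈ N, fourierCoeff f ((k : ℤ) + 1) = 0 := by
      induction k with
      | zero => simpa using hcon
      | succ k ih =>
        intro f hf
        have := ih _ (hN.backward f hf (hcon f hf))
        rw [fourierCoeff_zpowMul] at this
        convert this using 2
        push_cast; ring
    refine hne ((Submodule.eq_bot_iff _).2 fun f hf => ext_fourierCoeff fun n => ?_)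
    rw [fourierCoeff_zero]
    rcases lt_or_ge n 1 with hn | hn
    · exact hN.le hf n hn
    · have := hall (n - 1).toNat f hf
      rwa [Int.toNat_of_nonneg (by omega), sub_add_cancel] at this
  obtain ⟨f₀, hf₀, hf₀1⟩ := hex
  let p : L2 := N.starProjection (fourierLp 2 1)
  have hpN : p ∈ N := Submodule.starProjection_apply_mem _ _
  -- The projection of `z` onto `N` represents the first coefficient functional on `N`.
  have hp (f : L2) (hf : f ∈ N) : fourierCoeff f 1 = inner ℂ p f := by
    rw [fourierCoeff_eq_inner, ← sub_eq_zero, ← inner_sub_left]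
    exact Submodule.inner_left_of_mem_orthogonal hf (Submodule.sub_starProjection_mem_orthogonal _)
  have hp0 : p ≠ 0 := by
    intro h
    exact hf₀1 (by rw [hp f₀ hf₀, h, inner_zero_left])
  refine ⟨(‖p‖⁻¹ : ℂ) • p, N.smul_mem _ hpN, norm_smul_inv_norm hp0, ‖p‖, norm_pos_iff.2 hp0,
    fun f hf => ?_⟩
  rw [hp f hf, inner_smul_left, map_inv₀, Complex.conj_ofReal, mul_inv_cancel_left₀]
  exact_mod_cast norm_ne_zero_iff.2 hp0

/-- The operator `f ↦ z̄ (f - ⟨g, f⟩ g)` on a subspace that it leaves invariant. -/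
def reducedShift (N : Submodule ℂ L2) (g : L2)
    (h : ∀ f : N, zpowMul (-1) (f - inner ℂ g (f : L2) • g) ∈ N) : N →L[ℂ] N :=
  (((zpowMul (-1)).toContinuousLinearMap ∘L
    (ContinuousLinearMap.id ℂ L2 - (innerSL ℂ g).smulRight g)) ∘L N.subtypeL).codRestrict N h

section Hitt

variable {N : Submodule ℂ L2} {g : L2}

theorem IsExtremal.reduced_mem (hg : IsExtremal N g) (hN : IsNearlyBackwardInvariant N)
    (f : N) : zpowMul (-1) (f - inner ℂ g (f : L2) • g) ∈ N := by
  obtain ⟨r, -, hr⟩ := hg.exists_coeff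
  have hm : (f - inner ℂ g (f : L2) • g : L2) ∈ N := N.sub_mem f.2 (N.smul_mem _ hg.mem)
  refine hN.backward _ hm ?_
  rw [hr _ hm, inner_sub_right, inner_smul_right, inner_self_eq_norm_sq_to_K, hg.norm_eq]
  simp

theorem coe_reducedShift (h : ∀ f : N, zpowMul (-1) (f - inner ℂ g (f : L2) • g) ∈ N) (f : N) :
    (reducedShift N g h f : L2) = zpowMul (-1) (f - inner ℂ g (f : L2) • g) := rfl

/-- Multiplication by `z̄` is isometric, so `R†R` is the projection of `N` onto the complement of
`g`. -/
theorem isDefectOne_reducedShift [CompleteSpace N] (hg : g ∈ N) (hg1 : ‖g‖ = 1)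
    (h : ∀ f : N, zpowMul (-1) (f - inner ℂ g (f : L2) • g) ∈ N) :
    IsDefectOne (reducedShift N g h) ⟨g, hg⟩ where
  norm_eq := hg1
  map_eq := by
    refine Subtype.ext ?_
    rw [coe_reducedShift, inner_self_eq_norm_sq_to_K, hg1]
    simp
  adjoint_map f := by
    refine ext_inner_left ℂ fun v => ?_
    rw [ContinuousLinearMap.adjoint_inner_right, Submodule.coe_inner, coe_reducedShift,
      coe_reducedShift, LinearIsometry.inner_map_map, Submodule.coe_inner]
    have hgg : inner ℂ g g = (1 : ℂ) := by
      rw [inner_self_eq_norm_sq_to_K, hg1]; simp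
    simp only [Submodule.coe_sub, Submodule.coe_smul, Submodule.coe_inner, inner_sub_left,
      inner_sub_right, inner_smul_left, inner_smul_right, hgg]
    ring

theorem zpowMul_pow_reducedShift (hg : g ∈ N)
    (h : ∀ f : N, zpowMul (-1) (f - inner ℂ g (f : L2) • g) ∈ N) (n : ℕ) (f : N) :
    zpowMul n ((reducedShift N g h ^ n) f) =
      f - ∑ k ∈ Finset.range n,
        inner ℂ (⟨g, hg⟩ : N) ((reducedShift N g h ^ k) f) • zpowMul k g := by
  induction n with
  | zero => simp [zpowMul_zero]
  | succ n ih =>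
    rw [Finset.sum_range_succ, pow_succ_apply, coe_reducedShift, zpowMul_zpowMul, ← sub_sub, ← ih]
    push_cast
    rw [add_neg_cancel_right, map_sub, map_smul]
    rfl

/-- The coefficient series of `f` with respect to the powers of `reducedShift`, as a function `h`
in the Hardy space, satisfies `f = g h`. -/
theorem coeFn_eq_mul_of_coeff (hN : N ≤ H2zero) (hg : g ∈ N)
    (h : ∀ f : N, zpowMul (-1) (f - inner ℂ g (f : L2) • g) ∈ N) (f : N) {u : L2} (hu : u ∈ H2)
    (hc : ∀ n : ℕ, fourierCoeff u n = inner ℂ (⟨g, hg⟩ : N) ((reducedShift N g h ^ n) f)) :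
    ∀ᵐ t ∂haarAddCircle, (f : L2) t = g t * u t := by
  have hgi : Integrable (fun t => g t * u t) haarAddCircle :=
    (Lp.memLp g).integrable_mul (Lp.memLp u)
  have hfi : Integrable (f : L2) haarAddCircle := (Lp.memLp (f : L2)).integrable one_le_two
  have hz : (fun t => (f : L2) t - g t * u t) =ᵐ[haarAddCircle] 0 := by
    refine ae_eq_zero_of_fourierCoeff_eq_zero (hfi.sub hgi) fun m => ?_
    have hs : fourierCoeff (fun t => (f : L2) t - g t * u t : AddCircle (1 : ℝ) → ℂ) m =
        fourierCoeff (f : L2) m - fourierCoeff (fun t => g t * u t : AddCircle (1 : ℝ) → ℂ) m := by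
      simp only [fourierCoeff, smul_sub]
      exact integral_sub (hfi.fourier_smul _) (hgi.fourier_smul _)
    rw [hs, sub_eq_zero, fourierCoeff_mul_eq_inner]
    have hlim := ((innerSL ℂ (star (zpowMul (-m) g))).continuous.tendsto u).comp
      (tendsto_partialSum hu)
    refine tendsto_nhds_unique (tendsto_const_nhds.congr' ?_) hlim
    filter_upwards [eventually_ge_atTop m.toNat] with n hn
    simp only [Function.comp_apply, innerSL_apply_apply]
    rw [← fourierCoeff_mul_eq_inner]
    have hsum : fourierCoeff (fun t => g t *
        (∑ k ∈ Finset.range n, fourierCoeff u k • (fourierLp 2 (k : ℤ) : L2) : L2) t) m =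
        fourierCoeff (∑ k ∈ Finset.range n, fourierCoeff u k • zpowMul k g : L2) m := by
      refine congrFun (fourierCoeff_congr_ae ?_) m
      have h1 := coeFn_sum_smul_zpowMul (fun k => fourierCoeff u k) g n
      have h2 := coeFn_sum_smul_zpowMul (fun k => fourierCoeff u k) (fourierLp 2 0) n
      filter_upwards [h1, h2, coeFn_fourierLp_two 0] with t e1 e2 e3
      simp only [zpowMul_fourierLp, add_zero] at e2
      rw [e1, e2, e3, fourier_zero, one_mul]
    have hrem := zpowMul_pow_reducedShift hg h n f
    simp only [← hc] at hrem
    -- The remainder `zⁿRⁿf` lies in `zⁿ⁺¹H²`, so for `n ≥ m` the partial sum times `g` already has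
    -- the `m`-th coefficient of `f`.
    have hmem := zpowMul_mem_hardyFrom n (hN ((reducedShift N g h ^ n) f).2) m (by omega)
    rw [hrem, fourierCoeff_sub, sub_eq_zero] at hmem
    rw [hsum, hmem]
  filter_upwards [hz] with t ht
  exact sub_eq_zero.1 ht

theorem summable_coeff [CompleteSpace N] {R : N →L[ℂ] N} {g : N} (hR : IsDefectOne R g) (f : N) :
    Summable fun n => ‖inner ℂ g ((R ^ n) f)‖ ^ 2 := by
  refine summable_of_sum_range_le (c := ‖f‖ ^ 2) (fun _ => sq_nonneg _) fun n => ?_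
  have := hR.sum_norm_sq_add n f
  nlinarith [sq_nonneg ‖(R ^ n) f‖]

/-- Writing `x = gu`, the remainders are `g` times the tails of `u`, which tend to `0` in `L²`. The
bounded means dominate the averages of their squares, so the limit of the decreasing norms `‖Rⁿx‖`
must be `0`. -/
theorem tendsto_norm_pow_of_hasBoundedMeans [CompleteSpace N] (hN : N ≤ H2zero) (hg : g ∈ N)
    (hg1 : ‖g‖ = 1) (h : ∀ f : N, zpowMul (-1) (f - inner ℂ g (f : L2) • g) ∈ N) {x : N}
    (hx : HasBoundedMeans (reducedShift N g h) ⟨g, hg⟩ x) :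
    Tendsto (fun n => ‖(reducedShift N g h ^ n) x‖) atTop (𝓝 0) := by
  set R := reducedShift N g h with hRdef
  have hR : IsDefectOne R ⟨g, hg⟩ := isDefectOne_reducedShift hg hg1 h
  obtain ⟨K, hK⟩ := hx
  obtain ⟨u, hu, huc⟩ := exists_hardy_of_summable (summable_coeff hR x)
  have hmul := coeFn_eq_mul_of_coeff hN hg h x hu huc
  set a : ℕ → ℂ := fun k => inner ℂ (⟨g, hg⟩ : N) ((R ^ k) x) with ha
  let s (n : ℕ) (t : AddCircle (1 : ℝ)) : ℂ :=
    ∑ k ∈ Finset.range (n + 1), a k * fourier 1 t ^ k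
  -- With `n + 1` terms, as in `partialSumVec`; hence `y n` is `zⁿ⁺¹Rⁿ⁺¹x`.
  let y (n : ℕ) : L2 := x - ∑ k ∈ Finset.range (n + 1), a k • zpowMul k g
  let v (n : ℕ) : L2 := u - ∑ k ∈ Finset.range (n + 1), a k • (fourierLp 2 (k : ℤ) : L2)
  have hynorm (n : ℕ) : ‖y n‖ = ‖(R ^ (n + 1)) x‖ := by
    have := zpowMul_pow_reducedShift hg h (n + 1) x
    rw [show y n = _ from this.symm, LinearIsometry.norm_map]
    rfl
  have hyt (n : ℕ) : ∀ᵐ t ∂haarAddCircle, y n t = (x : L2) t - g t * s n t := by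
    filter_upwards [Lp.coeFn_sub (x : L2) (∑ k ∈ Finset.range (n + 1), a k • zpowMul k g : L2),
      coeFn_sum_smul_zpowMul a g (n + 1)] with t h1 h2
    rw [h1, Pi.sub_apply, h2]
  have hvt (n : ℕ) : ∀ᵐ t ∂haarAddCircle, v n t = u t - s n t := by
    filter_upwards [Lp.coeFn_sub u
      (∑ k ∈ Finset.range (n + 1), a k • (fourierLp 2 (k : ℤ) : L2) : L2),
      coeFn_sum_smul_zpowMul a (fourierLp 2 0) (n + 1), coeFn_fourierLp_two 0] with t h1 h2 h3
    simp only [zpowMul_fourierLp, add_zero] at h2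
    rw [h1, Pi.sub_apply, h2, h3, fourier_zero, one_mul]
  have hv : Tendsto (fun n => ‖v n‖) atTop (𝓝 0) := by
    have h1 := (tendsto_partialSum hu).comp (tendsto_add_atTop_nat 1)
    have h2 := (h1.const_sub u).norm
    simp only [sub_self, norm_zero, huc] at h2
    exact h2
  have hanti := hR.antitone_norm_pow x
  have hconv : Tendsto (fun n => ‖(R ^ n) x‖) atTop (𝓝 (⨅ n, ‖(R ^ n) x‖)) :=
    tendsto_atTop_ciInf hanti ⟨0, by rintro _ ⟨n, rfl⟩; exact norm_nonneg _⟩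
  have hc : (⨅ n, ‖(R ^ n) x‖) = 0 := by
    refine limit_eq_zero_of_dominated_means (μ := haarAddCircle) (u := v) (y := y) (g := g)
      (F := fun t => 2 * ‖(x : L2) t‖ ^ 2 + 2 * |K| * ‖g t‖ ^ 2) hv (fun n => ?_) ?_
      (fun m => ?_) ?_
    · filter_upwards [hyt n, hvt n, hmul] with t h1 h2 h3
      rw [h1, h2, h3]
      ring
    · exact ((Lp_two_integrable_norm_sq _).const_mul _).add
        ((Lp_two_integrable_norm_sq _).const_mul _)
    · filter_upwards [ae_all_iff.2 hyt] with t h1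
      have hs : ∑ n ∈ Finset.range m, ‖s n t‖ ^ 2 ≤ |K| * m := by
        refine le_trans ?_ ((hK (fourier 1 t) (fourier_norm_apply 1 t) m).trans
          (by gcongr; exact le_abs_self K))
        simp only [inner_partialSumVec]
        exact le_rfl
      have hpt (n : ℕ) : ‖y n t‖ ^ 2 ≤ 2 * ‖(x : L2) t‖ ^ 2 + 2 * ‖g t‖ ^ 2 * ‖s n t‖ ^ 2 := by
        rw [h1]
        have h2 := norm_sub_le ((x : L2) t) (g t * s n t)
        rw [norm_mul] at h2
        calc _ ≤ (‖(x : L2) t‖ + ‖g t‖ * ‖s n t‖) ^ 2 := by gcongr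
          _ ≤ _ := by nlinarith [sq_nonneg (‖(x : L2) t‖ - ‖g t‖ * ‖s n t‖)]
      have htot : ∑ n ∈ Finset.range m, ‖y n t‖ ^ 2 ≤
          m * (2 * ‖(x : L2) t‖ ^ 2 + 2 * |K| * ‖g t‖ ^ 2) := by
        calc _ ≤ ∑ n ∈ Finset.range m,
              (2 * ‖(x : L2) t‖ ^ 2 + 2 * ‖g t‖ ^ 2 * ‖s n t‖ ^ 2) :=
              Finset.sum_le_sum fun n _ => hpt n
          _ = m * (2 * ‖(x : L2) t‖ ^ 2) +
              2 * ‖g t‖ ^ 2 * ∑ n ∈ Finset.range m, ‖s n t‖ ^ 2 := by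
              rw [Finset.sum_add_distrib, Finset.sum_const, Finset.card_range, nsmul_eq_mul,
                Finset.mul_sum]
          _ ≤ m * (2 * ‖(x : L2) t‖ ^ 2) + 2 * ‖g t‖ ^ 2 * (|K| * m) := by gcongr
          _ = _ := by ring
      rcases Nat.eq_zero_or_pos m with rfl | hm
      · simp only [Finset.range_zero, Finset.sum_empty, mul_zero]
        positivity
      · rw [inv_mul_le_iff₀ (by exact_mod_cast hm)]
        exact htot
    · simp only [hynorm]
      exact hconv.comp (tendsto_add_atTop_nat 1)
  rwa [hc] at hconv

theorem tendsto_norm_pow_reducedShift [CompleteSpace N] (hN : N ≤ H2zero) (hg : g ∈ N)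
    (hg1 : ‖g‖ = 1) (h : ∀ f : N, zpowMul (-1) (f - inner ℂ g (f : L2) • g) ∈ N) (x : N) :
    Tendsto (fun n => ‖(reducedShift N g h ^ n) x‖) atTop (𝓝 0) := by
  have hR : IsDefectOne (reducedShift N g h) ⟨g, hg⟩ := isDefectOne_reducedShift hg hg1 h
  refine hR.tendsto_norm_pow_of_closure
    (S := Set.range fun j : ℕ => ((reducedShift N g h).adjoint ^ j) (⟨g, hg⟩ : N)) ?_ ?_ x
  · rintro _ ⟨j, rfl⟩
    exact tendsto_norm_pow_of_hasBoundedMeans hN hg hg1 h (hR.hasBoundedMeans_adjoint_pow j)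
  · intro f hf
    -- A vector orthogonal to all `R†ʲg` has zero coefficient series, so it equals `g · 0`.
    have hz (j : ℕ) : inner ℂ (⟨g, hg⟩ : N) ((reducedShift N g h ^ j) f) = 0 := by
      rw [← ContinuousLinearMap.adjoint_inner_left, ← ContinuousLinearMap.star_eq_adjoint, star_pow]
      exact hf _ ⟨j, rfl⟩
    have := coeFn_eq_mul_of_coeff hN hg h f (u := 0) H2.zero_mem fun n => by
      rw [fourierCoeff_zero, hz]
    refine Subtype.ext (Lp.ext ?_)
    filter_upwards [this, Lp.coeFn_zero ℂ 2 (haarAddCircle (T := (1 : ℝ)))] with t h1 h2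
    rw [h1, h2]
    simp

/-- Hitt's theorem: dividing by the extremal function embeds a nearly backward invariant
subspace isometrically into the Hardy space, as a backward invariant subspace. -/
theorem exists_isometry_of_isExtremal (hN : IsNearlyBackwardInvariant N) (hg : IsExtremal N g) :
    ∃ J : N →ₗᵢ[ℂ] L2, (∀ f, J f ∈ H2) ∧
      (∀ f : N, ∀ᵐ t ∂haarAddCircle, (f : L2) t = g t * J f t) ∧
      ∀ f, ∃ f', J f' = zpowMul (-1) (J f - fourierCoeff (J f) 0 • (fourierLp 2 0 : L2)) := by
  have : CompleteSpace N := hN.isClosed.completeSpace_coe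
  have h := hg.reduced_mem hN
  set R := reducedShift N g h with hRdef
  have hR : IsDefectOne R ⟨g, hg.mem⟩ := isDefectOne_reducedShift hg.mem hg.norm_eq h
  choose J hJ hJc using fun f : N => exists_hardy_of_summable (summable_coeff hR f)
  have hext {u v : L2} (hu : u ∈ H2) (hv : v ∈ H2)
      (huv : ∀ n : ℕ, fourierCoeff u n = fourierCoeff v n) : u = v := by
    refine ext_fourierCoeff fun n => ?_
    rcases lt_or_ge n 0 with hn | hn
    · rw [hu n hn, hv n hn]
    · have := huv n.toNat
      rwa [Int.toNat_of_nonneg hn] at this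
  let J' : N →ₗ[ℂ] L2 :=
    { toFun := J
      map_add' := fun a b => hext (hJ _) (H2.add_mem (hJ _) (hJ _)) fun n => by
        rw [fourierCoeff_add, hJc, hJc, hJc, map_add, inner_add_right]
      map_smul' := fun c a => hext (hJ _) (H2.smul_mem _ (hJ _)) fun n => by
        rw [RingHom.id_apply, fourierCoeff_smul, hJc, hJc, map_smul]; exact inner_smul_right (E := N) _ _ _ }
  refine ⟨⟨J', fun f => ?_⟩, hJ, fun f => coeFn_eq_mul_of_coeff hN.le hg.mem h f (hJ f) (hJc f),
    fun f => ⟨R f, ?_⟩⟩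
  · have h1 := (hasSum_norm_sq_fourierCoeff (hJ f)).tendsto_sum_nat
    have h2 := ((tendsto_norm_pow_reducedShift hN.le hg.mem hg.norm_eq h f).pow 2).const_sub
      (‖f‖ ^ 2)
    have h3 : ‖J f‖ ^ 2 = ‖f‖ ^ 2 := by
      refine tendsto_nhds_unique h1 ?_
      convert h2 using 2 with n
      · rw [← hR.sum_norm_sq_add n f, add_sub_cancel_right]
        simp only [hJc]
      · simp
    exact (sq_eq_sq₀ (norm_nonneg _) (norm_nonneg _)).1 h3
  · refine hext (hJ _) (fun n hn => ?_) fun n => ?_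
    · rw [fourierCoeff_zpowMul, fourierCoeff_sub, fourierCoeff_smul, fourierCoeff_fourierLp]
      change fourierCoeff (J f) (n - -1) - fourierCoeff (J f) 0 * _ = 0
      rcases eq_or_ne n (-1) with rfl | hn'
      · simp
      · rw [hJ f _ (by omega), if_neg (by omega)]
        simp
    · have h1 : fourierCoeff (J (R f)) n = fourierCoeff (J f) ((n + 1 : ℕ) : ℤ) := by
        rw [hJc, hJc, pow_succ]
        rfl
      have h2 : ¬ (n : ℤ) - -1 = 0 := by omega
      change fourierCoeff (J (R f)) n =
        fourierCoeff (zpowMul (-1) (J f - fourierCoeff (J f) 0 • (fourierLp 2 0 : L2))) n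
      rw [h1, fourierCoeff_zpowMul, fourierCoeff_sub, fourierCoeff_smul, fourierCoeff_fourierLp,
        if_neg h2, mul_zero, sub_zero, sub_neg_eq_add]
      push_cast
      rfl

end Hitt

/-! ### Model space or full Hardy space as the image. -/

theorem eq_mulSpace_range {N : Submodule ℂ L2} {g : L2} (J : N →ₗᵢ[ℂ] L2)
    (hJ : ∀ f : N, ∀ᵐ t ∂haarAddCircle, (f : L2) t = g t * J f t) :
    N = mulSpace g (LinearMap.range J.toLinearMap) := by
  ext f
  constructor
  · intro hf
    exact ⟨J ⟨f, hf⟩, ⟨_, rfl⟩, hJ ⟨f, hf⟩⟩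
  · rintro ⟨_, ⟨f', rfl⟩, h⟩
    have : f = f' := by
      refine Lp.ext ?_
      filter_upwards [h, hJ f'] with t h1 h2
      rw [h1, h2]
      rfl
    rw [this]
    exact f'.2

theorem inf_orthogonal_inf_orthogonal {E : Type*} [NormedAddCommGroup E] [InnerProductSpace ℂ E]
    {L K : Submodule ℂ E} [L.HasOrthogonalProjection] (hLK : L ≤ K) : K ⊓ (Lᗮ ⊓ K)ᗮ = L := by
  refine le_antisymm (fun x hx => ?_) (le_inf hLK fun x hx => ?_)
  · have hxK := hx.1
    rw [← Submodule.sup_orthogonal_inf_of_hasOrthogonalProjection hLK] at hxK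
    obtain ⟨l, hl, e, he, rfl⟩ := Submodule.mem_sup.1 hxK
    have h1 : inner ℂ e (l + e) = 0 := Submodule.inner_right_of_mem_orthogonal he hx.2
    rw [inner_add_right, Submodule.inner_left_of_mem_orthogonal hl he.1, zero_add,
      inner_self_eq_zero] at h1
    rwa [h1, add_zero]
  · rw [Submodule.mem_orthogonal]
    exact fun u hu => Submodule.inner_left_of_mem_orthogonal hx hu.1

/-- The complement in `H²` of the backward invariant image of `N` is shift invariant. By Beurling it
is `αH²`, with image `K_α`, or it is `0`, with image `H²`. -/
theorem eq_mulSpace_of_isExtremal {N : Submodule ℂ L2} {g : L2}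
    (hN : IsNearlyBackwardInvariant N) (hg : IsExtremal N g) :
    (∃ α, IsInner α ∧ (∀ h ∈ modelSpace α, MemLp (fun t => g t * h t) 2 haarAddCircle) ∧
      N = mulSpace g (modelSpace α)) ∨
    ((∀ᵐ t ∂haarAddCircle, ‖g t‖ = 1) ∧ N = mulSpace g H2) := by
  have : CompleteSpace N := hN.isClosed.completeSpace_coe
  obtain ⟨J, hJ2, hJ, hJb⟩ := exists_isometry_of_isExtremal hN hg
  have hNL := eq_mulSpace_range J hJ
  set L : Submodule ℂ L2 := LinearMap.range J.toLinearMap with hL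
  have hLcl : IsClosed (L : Set L2) := by
    have := J.isometry.isClosedEmbedding.isClosed_range
    rwa [hL, LinearMap.coe_range]
  have : CompleteSpace L := hLcl.completeSpace_coe
  have hLH : L ≤ H2 := by
    rintro _ ⟨f, rfl⟩
    exact hJ2 f
  have hLm (h : L2) (hh : h ∈ L) : MemLp (fun t => g t * h t) 2 haarAddCircle := by
    obtain ⟨f, rfl⟩ := hh
    exact (memLp_congr_ae (hJ f)).1 (Lp.memLp (f : L2))
  let E : Submodule ℂ L2 := Lᗮ ⊓ H2
  have hLE : H2 ⊓ Eᗮ = L := inf_orthogonal_inf_orthogonal hLH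
  by_cases hE : E = ⊥
  · right
    have hLtop : L = H2 := by rw [← hLE, hE]; simp
    rw [hLtop] at hNL
    refine ⟨unimodular_of_inner_zpowMul hg.norm_eq fun n hn => ?_, hNL⟩
    -- The preimage of `zⁿ` is `zⁿg`, so the isometry turns orthogonality of the monomials into `⟨g,
    -- zⁿg⟩ = 0`.
    have hmon (n : ℕ) : ∃ f : N, J f = fourierLp 2 (n : ℤ) ∧ (f : L2) = zpowMul n g := by
      have hm : (fourierLp 2 (n : ℤ) : L2) ∈ L := by
        rw [hLtop]
        intro m hm
        rw [fourierCoeff_fourierLp, if_neg (by omega)]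
      obtain ⟨f, hf⟩ := hm
      refine ⟨f, hf, Lp.ext ?_⟩
      filter_upwards [hJ f, coeFn_zpowMul n g, coeFn_fourierLp_two n] with t h1 h2 h3
      rw [h1, h2, show J f = _ from hf, h3, mul_comm]
    obtain ⟨f₀, hf₀, hf₀'⟩ := hmon 0
    obtain ⟨f, hf, hf'⟩ := hmon n
    rw [Nat.cast_zero, zpowMul_zero] at hf₀'
    have h1 : inner ℂ g (zpowMul n g) = inner ℂ f₀ f := by rw [Submodule.coe_inner, hf₀', hf']
    rw [h1, ← J.inner_map_map, hf₀, hf]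
    exact orthonormal_fourier.inner_eq_zero (by omega)
  · left
    have hEz (u : L2) (hu : u ∈ E) : zpowMul 1 u ∈ E := by
      refine ⟨?_, hardyFrom_mono (by omega) (zpowMul_mem_hardyFrom 1 hu.2)⟩
      refine (Submodule.mem_orthogonal' _ _).2 ?_
      rintro _ ⟨f, rfl⟩
      obtain ⟨f', hf'⟩ := hJb f
      change inner ℂ (zpowMul 1 u) (J f) = 0
      have h1 : inner ℂ u (J f') = 0 :=
        Submodule.inner_left_of_mem_orthogonal (show J f' ∈ L from ⟨f', rfl⟩) hu.1
      have h2 : inner ℂ (zpowMul 1 u) (fourierLp 2 0 : L2) = 0 := by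
        rw [← inner_conj_symm, ← fourierCoeff_eq_inner, fourierCoeff_zpowMul, hu.2 _ (by omega),
          map_zero]
      rw [hf', map_sub, map_smul, inner_sub_right, inner_smul_right, ← inner_zpowMul_left,
        ← inner_zpowMul_left, h2, mul_zero, sub_zero] at h1
      exact h1
    obtain ⟨α, hαE, hαu, hEα⟩ := exists_unimodular_of_shift_invariant
      ((Submodule.isClosed_orthogonal L).inter (isClosed_hardyFrom 0)) inf_le_right hEz hE
    have hmodel : modelSpace α = L := by
      rw [modelSpace, ← hEα]
      exact hLE
    exact ⟨α, ⟨hαE.2, hαu⟩, by rw [hmodel]; exact hLm, by rw [hmodel]; exact hNL⟩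

/-! ### Complex conjugation on `L²` and the space `conj(H₀²)`. -/

theorem mem_conjSpace_iff {N : Submodule ℂ L2} {f : L2} : f ∈ conjSpace N ↔ star f ∈ N := by
  constructor
  · rintro ⟨h, hh, e⟩
    have : star f = h := by
      refine Lp.ext ?_
      filter_upwards [e, Lp.coeFn_star f] with t h1 h2
      rw [h2, Pi.star_apply, h1, RCLike.star_def, Complex.conj_conj]
    rwa [this]
  · intro h
    refine ⟨star f, h, ?_⟩
    filter_upwards [Lp.coeFn_star f] with t h2
    rw [h2, Pi.star_apply, RCLike.star_def, Complex.conj_conj]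

theorem conjSpace_conjSpace (N : Submodule ℂ L2) : conjSpace (conjSpace N) = N := by
  ext f
  rw [mem_conjSpace_iff, mem_conjSpace_iff, star_star]

theorem conjSpace_mono {N N' : Submodule ℂ L2} (h : N ≤ N') : conjSpace N ≤ conjSpace N' :=
  fun f hf => by
    rw [mem_conjSpace_iff] at hf ⊢
    exact h hf

theorem inner_star_star (f g : L2) : inner ℂ (star f) (star g) = inner ℂ g f := by
  rw [L2.inner_def, L2.inner_def]
  refine integral_congr_ae ?_
  filter_upwards [Lp.coeFn_star f, Lp.coeFn_star g] with t h1 h2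
  rw [h1, h2, RCLike.inner_apply, RCLike.inner_apply, Pi.star_apply, Pi.star_apply,
    RCLike.star_def, Complex.conj_conj, mul_comm]

theorem norm_star_L2 (f : L2) : ‖(star f : L2)‖ = ‖f‖ := by
  rw [@norm_eq_sqrt_re_inner ℂ, @norm_eq_sqrt_re_inner ℂ L2, inner_star_star]

theorem star_sub_L2 (f g : L2) : (star (f - g) : L2) = star f - star g := by
  refine Lp.ext ?_
  filter_upwards [Lp.coeFn_star f, Lp.coeFn_star g, Lp.coeFn_star (f - g), Lp.coeFn_sub f g,
    Lp.coeFn_sub (star f) (star g)] with t h1 h2 h3 h4 h5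
  rw [h3, h5, Pi.star_apply, h4, Pi.sub_apply, Pi.sub_apply, h1, h2, star_sub]
  rfl

theorem isometry_star : Isometry (star : L2 → L2) :=
  Isometry.of_dist_eq fun f g => by
    rw [dist_eq_norm, dist_eq_norm, ← star_sub_L2, norm_star_L2]

theorem isClosed_conjSpace {N : Submodule ℂ L2} (hN : IsClosed (N : Set L2)) :
    IsClosed (conjSpace N : Set L2) := by
  have : (conjSpace N : Set L2) = star ⁻¹' (N : Set L2) := by
    ext f
    exact mem_conjSpace_iff
  rw [this]
  exact hN.preimage isometry_star.continuous

theorem star_zpowMul (n : ℤ) (f : L2) : star (zpowMul n f) = zpowMul (-n) (star f) := by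
  refine Lp.ext ?_
  filter_upwards [Lp.coeFn_star f, Lp.coeFn_star (zpowMul n f), coeFn_zpowMul n f,
    coeFn_zpowMul (-n) (star f)] with t h1 h2 h3 h4
  rw [h2, Pi.star_apply, h3, h4, h1, fourier_neg, star_mul', RCLike.star_def]
  rfl

theorem star_fourierLp (n : ℤ) : star (fourierLp 2 n : L2) = fourierLp 2 (-n) := by
  refine Lp.ext ?_
  filter_upwards [Lp.coeFn_star (fourierLp 2 n : L2), coeFn_fourierLp_two n,
    coeFn_fourierLp_two (-n)] with t h1 h2 h3
  rw [h1, h3, Pi.star_apply, h2, fourier_neg, RCLike.star_def]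

theorem fourierCoeff_star (f : L2) (n : ℤ) :
    fourierCoeff (star f : L2) n = conj (fourierCoeff f (-n)) := by
  rw [fourierCoeff_eq_inner, fourierCoeff_eq_inner, inner_conj_symm, ← inner_star_star, star_star,
    star_fourierLp]

theorem conjSpace_mulSpace (g : L2) (K : Submodule ℂ L2) :
    conjSpace (mulSpace g K) = mulSpace (star g) (conjSpace K) := by
  ext f
  rw [mem_conjSpace_iff]
  constructor
  · rintro ⟨h, hh, e⟩
    refine ⟨star h, by rwa [mem_conjSpace_iff, star_star], ?_⟩
    filter_upwards [e, Lp.coeFn_star f, Lp.coeFn_star g, Lp.coeFn_star h] with t h1 h2 h3 h4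
    rw [h3, h4, ← Complex.conj_conj (f t), Pi.star_apply, Pi.star_apply]
    rw [h2, Pi.star_apply, RCLike.star_def] at h1
    rw [h1, map_mul, RCLike.star_def]
  · rintro ⟨h, hh, e⟩
    refine ⟨star h, mem_conjSpace_iff.1 hh, ?_⟩
    filter_upwards [e, Lp.coeFn_star f, Lp.coeFn_star g, Lp.coeFn_star h] with t h1 h2 h3 h4
    rw [h2, h4, Pi.star_apply, Pi.star_apply, h1, h3, Pi.star_apply, star_mul', star_star]

theorem fourierCoeff_eq_zero_of_mem_conj {f : L2} (hf : f ∈ conjSpace H2zero) {n : ℤ}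
    (hn : 0 ≤ n) : fourierCoeff f n = 0 := by
  have := (mem_conjSpace_iff.1 hf) (-n) (by omega)
  rw [fourierCoeff_star, neg_neg] at this
  simpa using this

theorem mem_conj_H2zero {f : L2} (h : ∀ n : ℤ, 0 ≤ n → fourierCoeff f n = 0) :
    f ∈ conjSpace H2zero :=
  mem_conjSpace_iff.2 fun n hn => by
    rw [fourierCoeff_star, h _ (by omega), map_zero]

theorem inner_eq_zero_of_mem_conj {f g : L2} (hf : f ∈ conjSpace H2zero) (hg : g ∈ H2) :
    inner ℂ f g = 0 :=
  inner_eq_zero_of_fourierCoeff fun n => by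
    rcases lt_or_ge n 0 with hn | hn
    · exact Or.inr (hg n hn)
    · exact Or.inl (fourierCoeff_eq_zero_of_mem_conj hf hn)

theorem eq_zero_of_mem_conj_of_mem {f : L2} (hf : f ∈ conjSpace H2zero) (hg : f ∈ H2) : f = 0 :=
  inner_self_eq_zero.1 (inner_eq_zero_of_mem_conj hf hg)

theorem mulSpace_H2_le {θ : L2} (hθ : IsInner θ) : mulSpace θ H2 ≤ H2 := by
  intro f hf
  obtain ⟨h, hh, rfl⟩ := (mem_mulSpace_iff hθ.2).1 hf
  intro n hn
  rw [fourierCoeff_eq_inner, ← inner_conj_symm, inner_unimodularMul_left]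
  refine (map_eq_zero _).2 (inner_eq_zero_of_fourierCoeff fun m => ?_)
  rcases lt_or_ge m 0 with hm | hm
  · exact Or.inl (hh m hm)
  · right
    rw [fourierCoeff_eq_inner, ← inner_unimodularMul_left θ hθ.2, unimodularMul_fourierLp,
      ← inner_conj_symm, ← fourierCoeff_eq_inner, fourierCoeff_zpowMul, hθ.1 _ (by omega), map_zero]

/-! ### The dual shift on the two halves of `K_θ^⊥`. -/

theorem mulZ_eq (f : L2) : mulZ f = zpowMul 1 f := by
  refine Lp.ext ?_
  filter_upwards [(ContinuousLinearMap.mul ℂ ℂ).coeFn_holder (r := 2)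
    (fourierLp ⊤ 1 : Lp ℂ ⊤ (haarAddCircle (T := (1 : ℝ)))) f, coeFn_zpowMul 1 f,
    coeFn_fourierLp (T := (1 : ℝ)) ⊤ 1] with t h1 h2 h3
  rw [h2]
  refine h1.trans ?_
  rw [h3]
  rfl

/-- On vectors whose product with `z` remains in `K_θ^⊥`, near invariance under the dual of the
compressed shift is invariance under multiplication by `z`. -/
theorem NearlyDualShiftInvariant.zpowMul_mem {θ : L2} {M : Submodule ℂ L2}
    (hM : NearlyDualShiftInvariant θ M) {f : L2} (hf : f ∈ M)
    (hz : zpowMul 1 f ∈ (modelSpace θ)ᗮ) : zpowMul 1 f ∈ M := by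
  let x : (modelSpace θ)ᗮ := ⟨f, hM.1 hf⟩
  let y : (modelSpace θ)ᗮ := ⟨zpowMul 1 f, hz⟩
  have hUx : dualShift θ x = y := by
    change (modelSpace θ)ᗮ.orthogonalProjectionOnto (mulZ f) = y
    rw [mulZ_eq]
    exact Submodule.orthogonalProjectionOnto_mem_subspace_eq_self y
  -- Compressing by the projection does not affect the pairing with `zf ∈ K_θ^⊥`, and `⟨zv, zf⟩ =
  -- ⟨v, f⟩`.
  have hUy : ContinuousLinearMap.adjoint (dualShift θ) y = x := by
    refine ext_inner_left ℂ fun v => ?_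
    rw [ContinuousLinearMap.adjoint_inner_right]
    change inner ℂ ((modelSpace θ)ᗮ.orthogonalProjectionOnto (mulZ (v : L2))) y = _
    rw [Submodule.inner_orthogonalProjectionOnto_eq_of_mem_right, mulZ_eq, Submodule.coe_inner]
    exact (zpowMul 1).inner_map_map _ _
  have := hM.2.2 x hf ⟨y, hUy⟩
  rwa [hUx] at this

theorem H2zero_le_H2 : H2zero ≤ H2 := hardyFrom_mono (by omega)

theorem mem_orthogonal_modelSpace_of_mem_conj (θ : L2) {f : L2} (hf : f ∈ conjSpace H2zero) :
    f ∈ (modelSpace θ)ᗮ :=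
  (Submodule.mem_orthogonal' _ _).2 fun _ hu => inner_eq_zero_of_mem_conj hf hu.1

theorem mem_orthogonal_modelSpace_of_mem_mulSpace {θ : L2} {f : L2} (hf : f ∈ mulSpace θ H2) :
    f ∈ (modelSpace θ)ᗮ :=
  (Submodule.mem_orthogonal' _ _).2 fun _ hu => Submodule.inner_right_of_mem_orthogonal hf hu.2

theorem zpowMul_one_mem_mulSpace {θ : L2} (hθ : IsInner θ) {f : L2} (hf : f ∈ mulSpace θ H2) :
    zpowMul 1 f ∈ mulSpace θ H2 := by
  obtain ⟨h, hh, rfl⟩ := (mem_mulSpace_iff hθ.2).1 hf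
  rw [← unimodularMul_zpowMul]
  exact (mem_mulSpace_iff hθ.2).2
    ⟨_, hardyFrom_mono (by omega) (zpowMul_mem_hardyFrom 1 hh), rfl⟩

theorem zpowMul_one_mem_conj {f : L2} (hf : f ∈ conjSpace H2zero) (h : fourierCoeff f (-1) = 0) :
    zpowMul 1 f ∈ conjSpace H2zero :=
  mem_conj_H2zero fun n hn => by
    rw [fourierCoeff_zpowMul]
    rcases eq_or_ne n 0 with rfl | hn'
    · simpa using h
    · exact fourierCoeff_eq_zero_of_mem_conj hf (by omega)

/-! ### Classification of the two components. -/

theorem mulSpace_mulSpace {φ θ : L2} {K : Submodule ℂ L2}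
    (hθ : ∀ᵐ t ∂haarAddCircle, ‖θ t‖ = 1) {ψ : L2}
    (hψ : ∀ᵐ t ∂haarAddCircle, ψ t = θ t * φ t) :
    mulSpace ψ K = mulSpace φ (mulSpace θ K) := by
  ext f
  constructor
  · rintro ⟨h, hh, e⟩
    refine ⟨unimodularMul θ hθ h, (mem_mulSpace_iff hθ).2 ⟨h, hh, rfl⟩, ?_⟩
    filter_upwards [e, hψ, coeFn_unimodularMul θ hθ h] with t h1 h2 h3
    rw [h1, h2, h3]
    ring
  · rintro ⟨k, ⟨h, hh, e'⟩, e⟩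
    refine ⟨h, hh, ?_⟩
    filter_upwards [e, e', hψ] with t h1 h2 h3
    rw [h1, h2, h3]
    ring

theorem mulSpace_const {c : ℂ} (hc : c ≠ 0) {φ : L2} (hφ : ∀ᵐ t ∂haarAddCircle, φ t = c)
    (N : Submodule ℂ L2) : mulSpace φ N = N := by
  ext f
  constructor
  · rintro ⟨h, hh, e⟩
    have : f = c • h := by
      refine Lp.ext ?_
      filter_upwards [e, hφ, Lp.coeFn_smul c h] with t h1 h2 h3
      rw [h1, h2, h3, Pi.smul_apply, smul_eq_mul]
    rw [this]
    exact N.smul_mem _ hh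
  · intro hf
    refine ⟨c⁻¹ • f, N.smul_mem _ hf, ?_⟩
    filter_upwards [hφ, Lp.coeFn_smul c⁻¹ f] with t h2 h3
    rw [h2, h3, Pi.smul_apply, smul_eq_mul, mul_inv_cancel_left₀ hc]

/-- The closed `z`-invariant subspaces of `θH²`. -/
theorem eq_or_isInnerMultiplePart {θ : L2} (hθ : IsInner θ) {B : Submodule ℂ L2}
    (hcl : IsClosed (B : Set L2)) (hle : B ≤ mulSpace θ H2) (hz : ∀ f ∈ B, zpowMul 1 f ∈ B)
    (hne : B ≠ ⊥) : B = mulSpace θ H2 ∨ IsInnerMultiplePart θ B := by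
  obtain ⟨φ, hφB, hφ, hB⟩ := exists_unimodular_of_shift_invariant hcl
    (hle.trans (mulSpace_H2_le hθ)) hz hne
  obtain ⟨γ, hγ, e⟩ := hle hφB
  have hγu : ∀ᵐ t ∂haarAddCircle, ‖γ t‖ = 1 := by
    filter_upwards [e, hφ, hθ.2] with t h1 h2 h3
    rwa [h1, norm_mul, h3, one_mul] at h2
  rw [mulSpace_mulSpace hθ.2 e] at hB
  by_cases hc : ∃ c : ℂ, ∀ᵐ t ∂haarAddCircle, γ t = c
  · left
    obtain ⟨c, hc⟩ := hc
    have hc0 : c ≠ 0 := by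
      obtain ⟨t, h1, h2⟩ := (hc.and hγu).exists
      rw [← norm_ne_zero_iff, ← h1, h2]
      exact one_ne_zero
    rw [hB, mulSpace_const hc0 hc]
  · exact Or.inr ⟨γ, ⟨⟨hγ, hγu⟩, hc⟩, hB⟩

/-- The closed subspaces of `conj(H₀²)` that contain `zf` whenever they contain `f ⟂ z̄`. -/
theorem isConjInnerPart_or_exists {A : Submodule ℂ L2} (hcl : IsClosed (A : Set L2))
    (hle : A ≤ conjSpace H2zero)
    (hz : ∀ f ∈ A, fourierCoeff f (-1) = 0 → zpowMul 1 f ∈ A) (hne : A ≠ ⊥) :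
    IsConjInnerPart A ∨ ∃ g α : L2, IsExtremal (conjSpace A) g ∧ IsInner α ∧
      (∀ h ∈ conjSpace (modelSpace α), MemLp (fun t => (star g : L2) t * h t) 2 haarAddCircle) ∧
      A = mulSpace (star g) (conjSpace (modelSpace α)) := by
  have hN : IsNearlyBackwardInvariant (conjSpace A) :=
    { isClosed := isClosed_conjSpace hcl
      le := by
        have := conjSpace_mono hle
        rwa [conjSpace_conjSpace] at this
      backward := fun f hf hf1 => by
        rw [mem_conjSpace_iff] at hf ⊢
        rw [star_zpowMul]
        refine hz _ hf ?_
        rw [fourierCoeff_star, neg_neg, hf1, map_zero] }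
  have hNne : conjSpace A ≠ ⊥ := by
    intro h
    refine hne ((Submodule.eq_bot_iff _).2 fun f hf => ?_)
    have h1 : star f ∈ conjSpace A := by rwa [mem_conjSpace_iff, star_star]
    rw [h, Submodule.mem_bot] at h1
    rw [← norm_eq_zero, ← norm_star_L2, h1, norm_zero]
  obtain ⟨g, hg⟩ := hN.exists_isExtremal hNne
  rcases eq_mulSpace_of_isExtremal hN hg with ⟨α, hα, hm, hA⟩ | ⟨hgu, hA⟩
  · refine Or.inr ⟨g, α, hg, hα, fun h hh => ?_, ?_⟩
    · have := (hm _ (mem_conjSpace_iff.1 hh)).star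
      refine (memLp_congr_ae ?_).1 this
      filter_upwards [Lp.coeFn_star g, Lp.coeFn_star h] with t h1 h2
      rw [Pi.star_apply, h1, h2, Pi.star_apply, Pi.star_apply, star_mul', star_star]
    · rw [← conjSpace_mulSpace, ← hA, conjSpace_conjSpace]
  · refine Or.inl ⟨g, ⟨H2zero_le_H2 (hN.le hg.mem), hgu⟩, hN.le hg.mem 0 (by omega), ?_, ?_⟩
    -- The first coefficient of `g` is `r⟨g, g⟩ = r > 0`: extremality is what makes the zero simple.
    · obtain ⟨r, hr, h⟩ := hg.exists_coeff
      rw [h g hg.mem, inner_self_eq_norm_sq_to_K, hg.norm_eq]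
      simpa using hr.ne'
    · rw [← hA, conjSpace_conjSpace]

/-- The component in `B ≤ H²` has no `z̄` coefficient, so passing from `A` to `M` changes neither
the functional `⟨z̄, ·⟩` on the `A`-component nor the vector representing it. -/
theorem IsExtremal.isDistinguished {M A B : Submodule ℂ L2} (hM : IsOrthSum M A B) {g : L2}
    (hB : B ≤ H2) (hg : IsExtremal (conjSpace A) g) : IsDistinguished M (star g) := by
  obtain ⟨r, hr, hcoeff⟩ := hg.exists_coeff
  have hgA : star g ∈ A := mem_conjSpace_iff.1 hg.mem
  have hAM : A ≤ M := hM.2 ▸ le_sup_left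
  refine ⟨⟨hAM hgA, ?_⟩, by rw [norm_star_L2, hg.norm_eq], r, hr, ?_⟩
  · refine (Submodule.mem_orthogonal _ _).2 ?_
    rintro x ⟨hxM, hx⟩
    have hx1 : fourierCoeff x (-1) = 0 := by
      rw [fourierCoeff_eq_inner]
      exact Submodule.inner_right_of_mem_orthogonal (Submodule.mem_span_singleton_self _) hx
    have hxM' : x ∈ A ⊔ B := hM.2 ▸ hxM
    obtain ⟨a, ha, b, hb, rfl⟩ := Submodule.mem_sup.1 hxM'
    rw [fourierCoeff_add, hB hb _ (by omega), add_zero] at hx1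
    have h1 : inner ℂ a (star g) = 0 := by
      have h2 := hcoeff (star a) (by rwa [mem_conjSpace_iff, star_star])
      rw [fourierCoeff_star, hx1, map_zero, eq_comm, mul_eq_zero,
        or_iff_right (by exact_mod_cast hr.ne')] at h2
      rwa [← inner_star_star, star_star]
    rw [inner_add_left, h1, zero_add]
    exact Submodule.inner_left_of_mem_orthogonal hgA
      ((Submodule.isOrtho_iff_le.1 hM.1.symm) hb)
  · rw [← fourierCoeff_eq_inner, fourierCoeff_star, neg_neg, hcoeff g hg.mem,
      inner_self_eq_norm_sq_to_K, hg.norm_eq]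
    simp

/-- A nearly `U_θ`-invariant subspace that splits along `conj(H₀²) ⊕ θH²` is the sum of its two
components, each of which is zero or of one of the types in the classification. -/
theorem NearlyDualShiftInvariant.component_cases {θ : L2} (hθ : IsInner θ)
    {M Mminus Mplus : Submodule ℂ L2} (hM : NearlyDualShiftInvariant θ M)
    (hminus_closed : IsClosed (Mminus : Set L2)) (hplus_closed : IsClosed (Mplus : Set L2))
    (hminus : Mminus ≤ conjSpace H2zero) (hplus : Mplus ≤ mulSpace θ H2)
    (hsum : IsOrthSum M Mminus Mplus) :
    (Mminus = ⊥ ∨ IsConjInnerPart Mminus ∨ IsModelPart M Mminus) ∧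
      (Mplus = ⊥ ∨ Mplus = mulSpace θ H2 ∨ IsInnerMultiplePart θ Mplus) := by
  have hplusH : Mplus ≤ H2 := hplus.trans (mulSpace_H2_le hθ)
  have hminusM : Mminus ≤ M := hsum.2 ▸ le_sup_left
  have hplusM : Mplus ≤ M := hsum.2 ▸ le_sup_right
  have hdec (f : L2) (hf : f ∈ M) : ∃ a ∈ Mminus, ∃ b ∈ Mplus, a + b = f := by
    rw [hsum.2] at hf
    exact Submodule.mem_sup.1 hf
  have hplus_inv (f : L2) (hf : f ∈ Mplus) : zpowMul 1 f ∈ Mplus := by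
    have hz := zpowMul_one_mem_mulSpace hθ (hplus hf)
    obtain ⟨a, ha, b, hb, hab⟩ := hdec _ (hM.zpowMul_mem (hplusM hf)
      (mem_orthogonal_modelSpace_of_mem_mulSpace hz))
    -- The `M_-` component of `zf` is a difference of elements of `H²`, so it lies in `H² ∩
    -- conj(H₀²) = 0`.
    have ha0 : a = 0 := by
      refine eq_zero_of_mem_conj_of_mem (hminus ha) ?_
      rw [eq_sub_of_add_eq hab]
      exact H2.sub_mem (mulSpace_H2_le hθ hz) (hplusH hb)
    rwa [← hab, ha0, zero_add]
  have hminus_inv (f : L2) (hf : f ∈ Mminus) (hf1 : fourierCoeff f (-1) = 0) :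
      zpowMul 1 f ∈ Mminus := by
    have hz := zpowMul_one_mem_conj (hminus hf) hf1
    obtain ⟨a, ha, b, hb, hab⟩ := hdec _ (hM.zpowMul_mem (hminusM hf)
      (mem_orthogonal_modelSpace_of_mem_conj θ hz))
    have hb0 : b = 0 := by
      refine eq_zero_of_mem_conj_of_mem ?_ (hplusH hb)
      rw [eq_sub_of_add_eq' hab]
      exact (conjSpace H2zero).sub_mem hz (hminus ha)
    rwa [← hab, hb0, add_zero]
  refine ⟨or_iff_not_imp_left.2 fun h => ?_, or_iff_not_imp_left.2 fun h =>
    eq_or_isInnerMultiplePart hθ hplus_closed hplus hplus_inv h⟩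
  refine (isConjInnerPart_or_exists hminus_closed hminus hminus_inv h).imp_right ?_
  rintro ⟨g, α, hg, hα, hm, hA⟩
  exact ⟨star g, α, hg.isDistinguished hsum hplusH, hminus (mem_conjSpace_iff.1 hg.mem),
    hα, hm, hA⟩

end DualShift

end

/-! ### Assembling the forms. -/

theorem theorem3p5 (θ : DualShift.L2) (hθ : DualShift.IsInner θ) (hθ0 : fourierCoeff θ 0 = 0)
    (M Mminus Mplus : Submodule ℂ DualShift.L2)
    (hM : DualShift.NearlyDualShiftInvariant θ M)
    (hbot : M ≠ ⊥) (htop : M ≠ (DualShift.modelSpace θ)ᗮ)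
    (hminus_closed : IsClosed (Mminus : Set DualShift.L2))
    (hplus_closed : IsClosed (Mplus : Set DualShift.L2))
    (hminus : Mminus ≤ DualShift.conjSpace DualShift.H2zero)
    (hplus : Mplus ≤ DualShift.mulSpace θ DualShift.H2)
    (hsum : DualShift.IsOrthSum M Mminus Mplus) :
    M = DualShift.mulSpace θ DualShift.H2 ∨
    DualShift.IsInnerMultiplePart θ M ∨
    M = DualShift.conjSpace DualShift.H2zero ∨
    DualShift.IsModelPart M M ∨
    (∃ B, DualShift.IsInnerMultiplePart θ B ∧
      DualShift.IsOrthSum M (DualShift.conjSpace DualShift.H2zero) B) ∨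
    (∃ A B, DualShift.IsModelPart M A ∧ DualShift.IsInnerMultiplePart θ B ∧
      DualShift.IsOrthSum M A B) ∨
    (∃ A, DualShift.IsModelPart M A ∧
      DualShift.IsOrthSum M A (DualShift.mulSpace θ DualShift.H2)) ∨
    DualShift.IsConjInnerPart M ∨
    (∃ A, DualShift.IsConjInnerPart A ∧
      DualShift.IsOrthSum M A (DualShift.mulSpace θ DualShift.H2)) ∨
    (∃ A B, DualShift.IsConjInnerPart A ∧ DualShift.IsInnerMultiplePart θ B ∧
      DualShift.IsOrthSum M A B) := by
  obtain ⟨hQ, hP⟩ := hM.component_cases hθ hminus_closed hplus_closed hminus hplus hsum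
  have hMP : Mminus = ⊥ → M = Mplus := fun h => by rw [hsum.2, h, bot_sup_eq]
  have hMQ : Mplus = ⊥ → M = Mminus := fun h => by rw [hsum.2, h, sup_bot_eq]
  -- Of the nine combinations, `0 ⊕ 0` is excluded by `hbot`. The other eight never need the two
  -- forms with `conj(H₀²)`, which are absorbed by `η = z`.
  rcases hQ with hQ | hQ | hQ <;> rcases hP with hP | hP | hP
  · exact absurd ((hMP hQ).trans hP) hbot
  · exact Or.inl ((hMP hQ).trans hP)
  · exact Or.inr (Or.inl (hMP hQ ▸ hP))
  · exact Or.inr (Or.inr (Or.inr (Or.inr (Or.inr (Or.inr (Or.inr (Or.inl (hMQ hP ▸ hQ))))))))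
  · exact Or.inr (Or.inr (Or.inr (Or.inr (Or.inr (Or.inr (Or.inr (Or.inr
      (Or.inl ⟨Mminus, hQ, hP ▸ hsum⟩))))))))
  · exact Or.inr (Or.inr (Or.inr (Or.inr (Or.inr (Or.inr (Or.inr (Or.inr
      (Or.inr ⟨Mminus, Mplus, hQ, hP, hsum⟩))))))))
  · refine Or.inr (Or.inr (Or.inr (Or.inl ?_)))
    rwa [← hMQ hP] at hQ
  · exact Or.inr (Or.inr (Or.inr (Or.inr (Or.inr (Or.inr (Or.inl ⟨Mminus, hQ, hP ▸ hsum⟩))))))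
  · exact Or.inr (Or.inr (Or.inr (Or.inr (Or.inr (Or.inl ⟨Mminus, Mplus, hQ, hP, hsum⟩)))))
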